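/- A digraph here is a finite directed graph in which parallel edges and self-loops are allowed. A cycle is a directed cycle, i.e. a nonempty cyclic sequence of edges, each ending where the next one starts, that visits no vertex twice; a self-loop is a cycle of length one. Cycles using different edges of the same multi-edge are counted as different. $C(G)$ denotes the number of cycles of $G$. For integers $n\ge 0$, $k\ge 2$ let $\mathcal G^{n,k}_{\mathrm{multi}}$ be the set of digraphs on $n$ vertices in which every vertex has outdegree exactly $k$ (counted with multiplicity) and the multiplicity of every edge between two distinct vertices is at most $k-1$ (self-loops may have any multiplicity up to $k$). Put $$F_k(n)=\max_{G\in\mathcal G^{n,k}_{\mathrm{multi}}} C(G),\qquad \alpha(k)=\frac{k-1+\sqrt{(k-1)^2+4}}{2}.$$ For $n\ge 3$ let $G_{n,k}$ be the circulant digraph on $v_0,\dots,v_{n-1}$ in which the edge $(v_i,v_j)$ has multiplicity $k-1$ if $j-i\equiv 1 \pmod n$, multiplicity $1$ if $j-i\equiv 2\pmod n$, and is absent otherwise. Theorem. For every integer $k\ge 2$, $$F_k(n)=\Theta(\alpha(k)^n)\quad\text{as } n\to\infty .$$ Explicitly, $F_k(n)\le 5\,\alpha(k)^n$ for all $n\ge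 0$, and for all $n\ge 3$ one has $G_{n,k}\in\mathcal G^{n,k}_{\mathrm{multi}}$ and $F_k(n)\ge C(G_{n,k})\ge \alpha(k)^n$. In particular, $F_2(n)=\Theta(\mathrm{Fib}_n)$ as $n\to\infty$, where $\mathrm{Fib}_n$ is the $n$-th Fibonacci number. -/

import Mathlib

open Filter Asymptotics

/-- A finite-multiplicity directed multigraph on the vertex set `V`, self-loops allowed:
`mult u v` is the number of parallel edges from `u` to `v`. -/
structure MultiDigraph (V : Type*) where
  mult : V → V → ℕ

namespace MultiDigraph

variable {V : Type*}

/-- The individual edges: parallel edges are distinct. -/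
abbrev Edge (G : MultiDigraph V) : Type _ :=
  Σ p : V × V, Fin (G.mult p.1 p.2)

/-- The initial vertex of an edge. -/
def src (G : MultiDigraph V) (e : G.Edge) : V := e.1.1

/-- The terminal vertex of an edge. -/
def tgt (G : MultiDigraph V) (e : G.Edge) : V := e.1.2

/-- A directed cycle: a nonempty cyclic sequence of edges (a list of edges up to rotation) in which
each edge ends where the (cyclically) next one starts, and which visits no vertex twice.
A self-loop is a cycle of length one. -/
def IsDirectedCycle (G : MultiDigraph V) (c : Cycle G.Edge) : Prop :=
  c ≠ Cycle.nil ∧ c.Chain (fun e f => G.tgt e = G.src f) ∧ (c.map G.src).Nodup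

/-- The number of directed cycles of `G`. Cycles that use different edges of the same multi-edge
are different. -/
noncomputable def numCycles (G : MultiDigraph V) : ℕ :=
  Nat.card {c : Cycle G.Edge // G.IsDirectedCycle c}

/-- A digraph on finitely many vertices has only finitely many cycles, so `numCycles` is a genuine
count. -/
theorem finite_directedCycles [Finite V] (G : MultiDigraph V) :
    Finite {c : Cycle G.Edge // G.IsDirectedCycle c} := by
  classical
  have := Fintype.ofFinite V
  have h : ∀ c : Cycle G.Edge, G.IsDirectedCycle c → c.Nodup := by
    intro c hc
    induction c using Quotient.inductionOn' with
    | _ l => exact List.Nodup.of_map G.src hc.2.2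
  exact Finite.of_injective
    (fun c : {c : Cycle G.Edge // G.IsDirectedCycle c} =>
      (⟨c.1, h c.1 c.2⟩ : {c : Cycle G.Edge // c.Nodup}))
    (fun a b hab => Subtype.ext (congrArg (fun x => x.1) hab))

/-- The digraphs on `n` vertices with every outdegree (counted with multiplicity) exactly `k`, in
which an edge between distinct vertices has multiplicity at most `k - 1`. -/
def multiClass (n k : ℕ) : Set (MultiDigraph (Fin n)) :=
  {G | (∀ u, ∑ v, G.mult u v = k) ∧ ∀ u v, u ≠ v → G.mult u v ≤ k - 1}

/-- The maximum number of directed cycles of a digraph in `multiClass n k`. -/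
noncomputable def maxCycles (k n : ℕ) : ℕ :=
  sSup (numCycles '' multiClass n k)

theorem multiClass_nonempty (n k : ℕ) : (multiClass n k).Nonempty := by
  refine ⟨⟨fun u v => if u = v then k else 0⟩, fun u => ?_, fun u v h => ?_⟩
  · simp
  · simp [h]

theorem multiClass_finite (n k : ℕ) : (multiClass n k).Finite := by
  have hb : ({f : Fin n → Fin n → ℕ | ∀ u v, f u v ≤ k}).Finite := by
    have h := Set.finite_Iic (fun _ _ => k : Fin n → Fin n → ℕ)
    exact h.subset fun f hf u v => hf u v
  refine Set.Finite.of_finite_image (f := mult) (hb.subset ?_) ?_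
  · rintro _ ⟨G, hG, rfl⟩ u v
    rw [← hG.1 u]
    exact Finset.single_le_sum (f := fun w => G.mult u w) (fun _ _ => Nat.zero_le _)
      (Finset.mem_univ v)
  · rintro ⟨f⟩ _ ⟨g⟩ _ h
    exact congrArg _ h

/-- `maxCycles k n` is a maximum, not merely a supremum. -/
theorem isGreatest_maxCycles (k n : ℕ) :
    IsGreatest (numCycles '' multiClass n k) (maxCycles k n) :=
  have hbdd := ((multiClass_finite n k).image numCycles).bddAbove
  ⟨Nat.sSup_mem ((multiClass_nonempty n k).image _) hbdd, fun _ h => le_csSup hbdd h⟩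

/-- The circulant digraph on `v_0, …, v_{n-1}` in which the edge from `v_i` to `v_j` has
multiplicity `k - 1` if `j - i ≡ 1 (mod n)`, multiplicity `1` if `j - i ≡ 2 (mod n)`, and is absent
otherwise. (It is used for `n ≥ 3`, where the two congruences exclude each other.) -/
def circulant (n k : ℕ) : MultiDigraph (Fin n) where
  mult i j :=
    if ((j : ℕ) : ℤ) - ((i : ℕ) : ℤ) ≡ 1 [ZMOD n] then k - 1
    else if ((j : ℕ) : ℤ) - ((i : ℕ) : ℤ) ≡ 2 [ZMOD n] then 1
    else 0

end MultiDigraph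

/-- The growth rate `(k - 1 + √((k - 1)² + 4)) / 2`. -/
noncomputable def cycleGrowth (k : ℕ) : ℝ :=
  ((k : ℝ) - 1 + Real.sqrt (((k : ℝ) - 1) ^ 2 + 4)) / 2

/-! Write `a = k - 1`, and let `α = cycleGrowth k` be the positive root of `α ^ 2 = a * α + 1`. A
cycle read from its least vertex `i` is a closed path at `i` inside `Finset.Ici i`, so the number of
cycles is a sum of weighted path counts (`numCycles_eq_sum_pathCount`). Each of them is at most `α ^
|U| + 1` with `U = Finset.Ici i` (`pathCount_le`), and a geometric sum gives the upper bound.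

For one base point `t`, a path leaves every vertex at most once, so the path count is affine in each
row of the multiplicity matrix. Every row may therefore be replaced by an extreme one: weight `a` on
a heavy target `p y` and weight `1` on a light target `s y ≠ p y`. Only a loop at `t` closes a
cycle, which costs the additive `1` (`exists_twoStep_le`).

For such two-target rows, each vertex still available carries a local weight, and the product of the
weights dominates the path count (`step_le`, `pathCount_le_total`). Visiting `v` deprives the rows
with light target `v` of that option, and each loss gains a factor `ρ` at the heavy target of the
row. At the start a vertex with `q` heavy in-rows weighs at most `γ * Γ ^ q`. The numbers `q` sum to
`|U|` and `γ * Γ = α`, so the product is at most `α ^ |U|`. Suitable weights are explicit functions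
of `α` for `k ≥ 3` (`sequenceBounds_of_eq`) and simpler ones for `k = 2` (`parameters_golden`).

For the lower bound, let `u` be `lucasSeq a`. In the circulant, the cycles winding once contribute
at least `u n` through `v_0` and at least `u (n - 2)` avoiding it. The sum is `α ^ n + β ^ n` with
`β = -1 / α` (`lucasSeq_add`). For odd `n` the negative term is made up for by the cycle of steps of
length two, which winds twice. -/

/-- Weighted number of paths which start at `x`, visit vertices of `S` without repetition, and stop
as soon as they reach `t`; a step `u → v` has weight `M u v`. The first argument after `t` bounds
the number of steps. -/
def pathCount {V : Type*} [DecidableEq V] (M : V → V → ℕ) (t : V) : ℕ → Finset V → V → ℕ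
  | 0, _, _ => 0
  | n + 1, S, x => ∑ v ∈ S, M x v * (if v = t then 1 else pathCount M t n (S.erase v) v)

/-- The weights with `a` at `p x` and `1` at `s x` in row `x`. -/
def twoStep {V : Type*} [DecidableEq V] (a : ℕ) (p s : V → V) (x v : V) : ℕ :=
  (if v = p x then a else 0) + (if v = s x then 1 else 0)

/-! ### The product potential for rows with one heavy and one light target. -/

/-- Local weights from which one builds a quantity that dominates `pathCount (twoStep a p s)`. For
a vertex `w` that may still be visited, the arguments of `g` record the number of usable rows `y`
with `p y = w` and `s y` available, whether there is one with `p y = w` and `s y` lost, and the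
number of those with `s y = w` and `p y` available. -/
structure CyclePotential (a α : ℝ) where
  ρ : ℝ
  g : ℕ → Bool → ℕ → ℝ
  γ : ℝ
  Γ : ℝ
  rho_nonneg : 0 ≤ ρ
  rho_le_one : ρ ≤ 1
  one_le : ∀ q h r, 1 ≤ g q h r
  mono : ∀ q h r, g q h r ≤ g q h (r + 1)
  halve : ∀ q h r, g q true r ≤ ρ * g (q + 1) h r
  half_move : ∀ q r, a * ρ ^ r ≤ g q true r
  full_move : ∀ q₁ h₁ r₁ q₂ h₂ r₂, a * ρ ^ r₁ * g q₂ h₂ r₂ + ρ ^ r₂ * g q₁ h₁ r₁ ≤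
    g (q₁ + 1) h₁ r₁ * g q₂ h₂ (r₂ + 1)
  init : ∀ q r, g q false r ≤ γ * Γ ^ q
  mul_eq : γ * Γ = α

namespace CyclePotential

variable {a α : ℝ} (P : CyclePotential a α)

theorem g_nonneg (q : ℕ) (h : Bool) (r : ℕ) : 0 ≤ P.g q h r := zero_le_one.trans (P.one_le q h r)

theorem g_mono (q : ℕ) (h : Bool) : Monotone (P.g q h) := monotone_nat_of_le_succ (P.mono q h)

theorem halve_iterate (q : ℕ) (h : Bool) {r r' : ℕ} (hr : r' ≤ r) (n : ℕ) :
    P.g q (h || decide (0 < n)) r' ≤ P.ρ ^ n * P.g (q + n) h r := by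
  induction n generalizing q with
  | zero => simpa using P.g_mono q h hr
  | succ n ih =>
    have h1 : P.g q true r' ≤ P.ρ * P.g (q + 1) (h || decide (0 < n)) r' := P.halve _ _ _
    have h2 := ih (q + 1)
    have h3 : q + 1 + n = q + (n + 1) := by ring
    rw [h3] at h2
    simp only [Nat.zero_lt_succ, decide_true, Bool.or_true]
    calc _ ≤ _ := h1
      _ ≤ P.ρ * (P.ρ ^ n * P.g (q + (n + 1)) h r) := mul_le_mul_of_nonneg_left h2 P.rho_nonneg
      _ = _ := by ring

variable {V : Type*} [DecidableEq V] (p s : V → V)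

/-- The number of rows of `T` with heavy target `w` and light target in `S`. -/
def fullCount (S T : Finset V) (w : V) : ℕ := (T.filter fun y => p y = w ∧ s y ∈ S).card

/-- Whether some row of `T` has heavy target `w` and light target outside `S`. -/
def hasHalf (S T : Finset V) (w : V) : Bool := decide (∃ y ∈ T, p y = w ∧ s y ∉ S)

/-- The number of rows of `T` with light target `w` and heavy target in `S`. -/
def lightCount (S T : Finset V) (w : V) : ℕ := (T.filter fun y => s y = w ∧ p y ∈ S).card

/-- The local weight at the vertex `w`. -/
def weight (S T : Finset V) (w : V) : ℝ :=
  P.g (fullCount p s S T w) (hasHalf p s S T w) (lightCount p s S T w)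

/-- The product of all local weights. -/
def total (S T : Finset V) : ℝ := ∏ w ∈ S, P.weight p s S T w

theorem one_le_weight (S T : Finset V) (w : V) : 1 ≤ P.weight p s S T w := P.one_le _ _ _

theorem weight_nonneg (S T : Finset V) (w : V) : 0 ≤ P.weight p s S T w := P.g_nonneg _ _ _

theorem one_le_prod_weight (U S T : Finset V) : 1 ≤ ∏ w ∈ U, P.weight p s S T w :=
  Finset.one_le_prod fun w _ => P.one_le_weight p s S T w

/-- When `v` disappears, the rows `w ← y → v` with heavy target `w` turn from full to half. Each of
them pays one factor `ρ` through `halve`, while a drop in the light count at `w` is harmless by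
monotonicity. -/
theorem weight_erase_le {S : Finset V} (T : Finset V) {v : V} (hv : v ∈ S) (w : V) :
    P.weight p s (S.erase v) T w ≤
      P.ρ ^ (T.filter fun y => p y = w ∧ s y = v).card * P.weight p s S T w := by
  have hq : fullCount p s S T w =
      fullCount p s (S.erase v) T w + (T.filter fun y => p y = w ∧ s y = v).card := by
    unfold fullCount
    rw [← Finset.card_union_of_disjoint]
    · congr 1
      ext y
      simp only [Finset.mem_filter, Finset.mem_union, Finset.mem_erase]
      by_cases h : s y = v
      · simp [h, hv]
      · simp [h]
    · rw [Finset.disjoint_filter]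
      rintro y - ⟨-, h1⟩ ⟨-, h2⟩
      simp [h2] at h1
  have hh : hasHalf p s (S.erase v) T w =
      (hasHalf p s S T w || decide (0 < (T.filter fun y => p y = w ∧ s y = v).card)) := by
    unfold hasHalf
    rw [← Bool.decide_or, decide_eq_decide]
    simp only [Finset.card_pos, Finset.Nonempty, Finset.mem_filter, Finset.mem_erase]
    constructor
    · rintro ⟨y, hy, h1, h2⟩
      by_cases h : s y = v
      · exact Or.inr ⟨y, hy, h1, h⟩
      · exact Or.inl ⟨y, hy, h1, fun h3 => h2 ⟨h, h3⟩⟩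
    · rintro (⟨y, hy, h1, h2⟩ | ⟨y, hy, h1, h2⟩)
      · exact ⟨y, hy, h1, fun h3 => h2 h3.2⟩
      · exact ⟨y, hy, h1, fun h3 => h3.1 h2⟩
  have hr : lightCount p s (S.erase v) T w ≤ lightCount p s S T w := by
    refine Finset.card_le_card fun y => ?_
    simp only [Finset.mem_filter, Finset.mem_erase]
    tauto
  unfold weight
  rw [hq, hh]
  exact P.halve_iterate _ _ hr _

/-- The rows with light target `v` and available heavy target are sorted by that heavy target, which
differs from `v`; the factors `ρ` from all the vertices multiply up. -/
theorem total_erase_le (hps : ∀ y, p y ≠ s y) {S : Finset V} (T : Finset V) {v : V} (hv : v ∈ S) :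
    P.total p s (S.erase v) T ≤
      P.ρ ^ lightCount p s S T v * ∏ w ∈ S.erase v, P.weight p s S T w := by
  have hn : lightCount p s S T v =
      ∑ w ∈ S.erase v, (T.filter fun y => p y = w ∧ s y = v).card := by
    unfold lightCount
    rw [Finset.card_eq_sum_card_fiberwise (f := p) (t := S.erase v)]
    · refine Finset.sum_congr rfl fun w hw => ?_
      congr 1
      ext y
      simp only [Finset.mem_filter, Finset.mem_erase] at hw ⊢
      constructor
      · tauto
      · rintro ⟨h1, h2, h3⟩
        exact ⟨⟨h1, h3, h2 ▸ hw.2⟩, h2⟩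
    · intro y hy
      simp only [Finset.coe_filter, Set.mem_ofPred_eq, Finset.coe_erase, Set.mem_sdiff,
        Finset.mem_coe, Set.mem_singleton_iff] at hy ⊢
      exact ⟨hy.2.2, fun h => hps y (h.trans hy.2.1.symm)⟩
  unfold total
  rw [hn, ← Finset.prod_pow_eq_pow_sum, ← Finset.prod_mul_distrib]
  exact Finset.prod_le_prod (fun w _ => P.weight_nonneg p s _ _ _)
    fun w _ => P.weight_erase_le p s T hv w

theorem filter_erase_eq (T : Finset V) (x : V) (Q : V → Prop) [DecidablePred Q] (h : ¬ Q x) :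
    (T.erase x).filter Q = T.filter Q := by
  ext y
  simp only [Finset.mem_filter, Finset.mem_erase]
  constructor
  · tauto
  · rintro ⟨h1, h2⟩
    exact ⟨⟨fun h3 => h (h3 ▸ h2), h1⟩, h2⟩

theorem card_filter_erase (T : Finset V) {x : V} (hx : x ∈ T) (Q : V → Prop) [DecidablePred Q]
    (h : Q x) : (T.filter Q).card = ((T.erase x).filter Q).card + 1 := by
  rw [Finset.filter_erase, Finset.card_erase_add_one]
  simp [hx, h]

theorem hasHalf_erase (S T : Finset V) (x w : V) (h : ¬ (p x = w ∧ s x ∉ S)) :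
    hasHalf p s S (T.erase x) w = hasHalf p s S T w := by
  unfold hasHalf
  rw [decide_eq_decide]
  constructor
  · rintro ⟨y, hy, h1⟩
    exact ⟨y, Finset.mem_of_mem_erase hy, h1⟩
  · rintro ⟨y, hy, h1⟩
    exact ⟨y, Finset.mem_erase.2 ⟨fun h3 => h (h3 ▸ h1), hy⟩, h1⟩

/-- The product of the local weights dominates one step of the path-counting recursion. -/
theorem step_le (ha : 0 ≤ a) (hps : ∀ y, p y ≠ s y) (S : Finset V) {T : Finset V} {x : V}
    (hx : x ∈ T) :
    (if p x ∈ S then a * P.total p s (S.erase (p x)) (T.erase x) else 0) +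
      (if s x ∈ S then P.total p s (S.erase (s x)) (T.erase x) else 0) ≤ P.total p s S T := by
  by_cases h1 : p x ∈ S <;> by_cases h2 : s x ∈ S
  · rw [if_pos h1, if_pos h2]
    have e1 := P.total_erase_le p s hps (T.erase x) h1
    have e2 := P.total_erase_le p s hps (T.erase x) h2
    have hm2 : s x ∈ S.erase (p x) := Finset.mem_erase.2 ⟨(hps x).symm, h2⟩
    have hm1 : p x ∈ S.erase (s x) := Finset.mem_erase.2 ⟨hps x, h1⟩
    have hother : ∀ w ∈ (S.erase (p x)).erase (s x),
        P.weight p s S (T.erase x) w = P.weight p s S T w := by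
      intro w hw
      simp only [Finset.mem_erase] at hw
      unfold weight fullCount lightCount
      rw [hasHalf_erase _ _ _ _ _ _ (by tauto), filter_erase_eq _ _ _ (fun h => hw.2.1 h.1.symm),
        filter_erase_eq _ _ _ (fun h => hw.1 h.1.symm)]
    set R := ∏ w ∈ (S.erase (p x)).erase (s x), P.weight p s S T w with hR
    have hR0 : 0 ≤ R := Finset.prod_nonneg fun w _ => P.weight_nonneg p s _ _ _
    rw [← Finset.mul_prod_erase _ _ hm2, Finset.prod_congr rfl hother, ← hR] at e1
    rw [← Finset.mul_prod_erase _ _ hm1, Finset.erase_right_comm, Finset.prod_congr rfl hother,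
      ← hR] at e2
    have e3 : P.total p s S T = P.weight p s S T (p x) * (P.weight p s S T (s x) * R) := by
      unfold total
      rw [← Finset.mul_prod_erase _ _ h1, ← Finset.mul_prod_erase _ _ hm2]
    have f1 : lightCount p s S (T.erase x) (p x) = lightCount p s S T (p x) := by
      unfold lightCount
      rw [filter_erase_eq _ _ _ (fun h => hps x h.1.symm)]
    have f2 : lightCount p s S T (s x) = lightCount p s S (T.erase x) (s x) + 1 :=
      card_filter_erase _ hx _ ⟨rfl, h1⟩
    have f3 : fullCount p s S T (p x) = fullCount p s S (T.erase x) (p x) + 1 :=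
      card_filter_erase _ hx _ ⟨rfl, h2⟩
    have f4 : fullCount p s S (T.erase x) (s x) = fullCount p s S T (s x) := by
      unfold fullCount
      rw [filter_erase_eq _ _ _ (fun h => hps x h.1)]
    have f5 : ∀ w, hasHalf p s S (T.erase x) w = hasHalf p s S T w := fun w =>
      hasHalf_erase _ _ _ _ _ _ (by tauto)
    rw [e3]
    unfold weight at e1 e2 ⊢
    rw [f1, f4, f5] at e1
    rw [f1, f5] at e2
    rw [f2, f3]
    -- Using up row `x` lowers by one the full count at `p x` and the light count at `s x`;
    -- `full_move` compares exactly these states.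
    have key := P.full_move (fullCount p s S (T.erase x) (p x)) (hasHalf p s S T (p x))
      (lightCount p s S T (p x)) (fullCount p s S T (s x)) (hasHalf p s S T (s x))
      (lightCount p s S (T.erase x) (s x))
    have k2 := mul_le_mul_of_nonneg_right key hR0
    have e1' := mul_le_mul_of_nonneg_left e1 ha
    linarith
  · rw [if_pos h1, if_neg h2, add_zero]
    have e1 := P.total_erase_le p s hps (T.erase x) h1
    have f1 : lightCount p s S (T.erase x) (p x) = lightCount p s S T (p x) := by
      unfold lightCount
      rw [filter_erase_eq _ _ _ (fun h => hps x h.1.symm)]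
    have hother : ∀ w ∈ S.erase (p x), P.weight p s S (T.erase x) w = P.weight p s S T w := by
      intro w hw
      simp only [Finset.mem_erase] at hw
      unfold weight fullCount lightCount
      rw [hasHalf_erase _ _ _ _ _ _ (fun h => hw.1 h.1.symm),
        filter_erase_eq _ _ _ (fun h => hw.1 h.1.symm),
        filter_erase_eq T x (fun y => s y = w ∧ p y ∈ S) (fun h => h2 (h.1.symm ▸ hw.2))]
    rw [f1, Finset.prod_congr rfl hother] at e1
    have hh : hasHalf p s S T (p x) = true := by
      unfold hasHalf
      exact decide_eq_true ⟨x, hx, rfl, h2⟩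
    have e3 : P.total p s S T =
        P.weight p s S T (p x) * ∏ w ∈ S.erase (p x), P.weight p s S T w := by
      unfold total
      rw [Finset.mul_prod_erase _ _ h1]
    rw [e3]
    have k := P.half_move (fullCount p s S T (p x)) (lightCount p s S T (p x))
    rw [← hh] at k
    have k2 := mul_le_mul_of_nonneg_right k
      (zero_le_one.trans (P.one_le_prod_weight p s (S.erase (p x)) S T))
    have e1' := mul_le_mul_of_nonneg_left e1 ha
    calc _ ≤ _ := e1'
      _ = _ := by ring
      _ ≤ _ := k2
  · rw [if_neg h1, if_pos h2, zero_add]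
    have e1 := P.total_erase_le p s hps (T.erase x) h2
    have hother : ∀ w ∈ S.erase (s x), P.weight p s S (T.erase x) w = P.weight p s S T w := by
      intro w hw
      simp only [Finset.mem_erase] at hw
      unfold weight fullCount lightCount
      rw [hasHalf_erase p s S T x w (fun h => h1 (h.1.symm ▸ hw.2)),
        filter_erase_eq T x (fun y => p y = w ∧ s y ∈ S) (fun h => h1 (h.1.symm ▸ hw.2)),
        filter_erase_eq _ _ _ (fun h => hw.1 h.1.symm)]
    rw [Finset.prod_congr rfl hother] at e1
    have e3 : P.total p s S T =
        P.weight p s S T (s x) * ∏ w ∈ S.erase (s x), P.weight p s S T w := by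
      unfold total
      rw [Finset.mul_prod_erase _ _ h2]
    rw [e3]
    -- Only the light target is left: its weight is at least `1`, which covers the factor `ρ ^ r ≤
    -- 1`.
    exact e1.trans (mul_le_mul_of_nonneg_right
      ((pow_le_one₀ P.rho_nonneg P.rho_le_one).trans (P.one_le_weight p s S T _))
      (zero_le_one.trans (P.one_le_prod_weight p s _ S T)))
  · rw [if_neg h1, if_neg h2, add_zero]
    exact zero_le_one.trans (P.one_le_prod_weight p s S S T)

theorem pathCount_twoStep_succ (m : ℕ) (t : V) (n : ℕ) (S : Finset V)
    (x : V) : pathCount (twoStep m p s) t (n + 1) S x =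
      (if p x ∈ S then m * (if p x = t then 1 else
        pathCount (twoStep m p s) t n (S.erase (p x)) (p x)) else 0) +
      (if s x ∈ S then (if s x = t then 1 else
        pathCount (twoStep m p s) t n (S.erase (s x)) (s x)) else 0) := by
  simp only [pathCount, twoStep, add_mul, Finset.sum_add_distrib, ite_mul, zero_mul, one_mul,
    Finset.sum_ite_eq']

/-- Here `T` holds the rows not yet used, including that of the current vertex `x`. The inclusion
`hST` guarantees that any vertex other than `t` still to be visited has its row in `T`. -/
theorem pathCount_le_total {m : ℕ} (ham : a = m) (hps : ∀ y, p y ≠ s y) (t : V) (n : ℕ)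
    {S T : Finset V} {x : V} (hx : x ∈ T) (hST : S.erase t ⊆ T.erase x) :
    (pathCount (twoStep m p s) t n S x : ℝ) ≤ P.total p s S T := by
  induction n generalizing S T x with
  | zero => simpa [pathCount, total] using zero_le_one.trans (P.one_le_prod_weight p s S S T)
  | succ n ih =>
    have ha : 0 ≤ a := ham ▸ Nat.cast_nonneg m
    refine le_trans ?_ (P.step_le p s ha hps S hx)
    have hv : ∀ v ∈ S, ((if v = t then 1 else
        pathCount (twoStep m p s) t n (S.erase v) v : ℕ) : ℝ) ≤
          P.total p s (S.erase v) (T.erase x) := by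
      intro v hv
      by_cases hvt : v = t
      · rw [if_pos hvt]
        simpa [total] using P.one_le_prod_weight p s (S.erase v) (S.erase v) (T.erase x)
      · rw [if_neg hvt]
        refine ih (hST (Finset.mem_erase.2 ⟨hvt, hv⟩)) ?_
        rw [Finset.erase_right_comm]
        exact Finset.erase_subset_erase _ hST
    rw [pathCount_twoStep_succ p s m, Nat.cast_add]
    refine add_le_add ?_ ?_
    · split_ifs with h h'
      · have := hv _ h
        rw [if_pos h'] at this
        push_cast at this ⊢
        rw [← ham]
        exact mul_le_mul_of_nonneg_left this ha
      · have := hv _ h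
        rw [if_neg h'] at this
        push_cast
        rw [← ham]
        exact mul_le_mul_of_nonneg_left this ha
      · simp
    · split_ifs with h h'
      · have := hv _ h
        rwa [if_pos h'] at this
      · have := hv _ h
        rwa [if_neg h'] at this
      · simp

/-- Since `S` is closed under `p` and `s`, no row is half at the start and `init` applies at every
vertex. The fibres of `p` partition `S`, so the exponents of `Γ` add up to `S.card`. -/
theorem pathCount_twoStep_le (P : CyclePotential a α) {m : ℕ} (ham : a = m) (hps : ∀ y, p y ≠ s y) {t : V} (n : ℕ)
    {S : Finset V} (ht : t ∈ S) (hp : ∀ y ∈ S, p y ∈ S) (hs : ∀ y ∈ S, s y ∈ S) :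
    (pathCount (twoStep m p s) t n S t : ℝ) ≤ α ^ S.card := by
  refine (P.pathCount_le_total p s ham hps t n ht subset_rfl).trans ?_
  have h1 : ∀ w ∈ S, P.weight p s S S w ≤ P.γ * P.Γ ^ (S.filter fun y => p y = w).card := by
    intro w hw
    have e1 : hasHalf p s S S w = false := by
      unfold hasHalf
      rw [decide_eq_false_iff_not]
      rintro ⟨y, hy, -, h⟩
      exact h (hs y hy)
    have e2 : fullCount p s S S w = (S.filter fun y => p y = w).card := by
      unfold fullCount
      congr 1
      ext y
      simp only [Finset.mem_filter]
      exact ⟨fun h => ⟨h.1, h.2.1⟩, fun h => ⟨h.1, h.2, hs y h.1⟩⟩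
    unfold weight
    rw [e1, e2]
    exact P.init _ _
  refine (Finset.prod_le_prod (fun w _ => P.weight_nonneg p s _ _ _) h1).trans ?_
  rw [Finset.prod_mul_distrib, Finset.prod_const, Finset.prod_pow_eq_pow_sum,
    ← Finset.card_eq_sum_card_fiberwise (f := p) (fun y hy => hp y hy), ← mul_pow, P.mul_eq]

end CyclePotential

/-! ### Explicit local weights and the inequalities that make them a potential. -/

namespace CyclePotential

/-- Numerical conditions under which explicit local weights form a `CyclePotential`. -/
structure Parameters (a α ρ Γ : ℝ) (O : ℕ → ℝ) : Prop where
  one_le_a : 1 ≤ a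
  a_le : a ≤ α
  sq_eq : α ^ 2 = a * α + 1
  rho_eq : ρ * α ^ 2 = a ^ 2 + 1
  one_le_kappa : 1 ≤ ρ * Γ
  kappa₁ : a * (α + 1) ≤ ρ * Γ * α ^ 2
  kappa₂ : a ^ 2 + a ≤ ρ * Γ * (a ^ 2 + 1)
  kappa₃ : a ^ 2 + α ≤ ρ * Γ * α ^ 2
  gamma₁ : a + 1 ≤ α * Γ
  zero : O 0 = 1
  mono : Monotone O
  mul_le : ∀ r, O r * Γ ≤ α
  light : ∀ r₁ r₂, a * ρ ^ r₁ * O r₂ + ρ ^ r₂ * O r₁ ≤ α * O (r₂ + 1)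
  half : ∀ r, a ^ 2 * ρ ^ r + O r ≤ a ^ 2 + 1
  double : ∀ r, a * O r + α * ρ ^ r ≤ α * Γ * O (r + 1)
  mixed : ∀ r, a * O r + a * ρ ^ r ≤ α * (ρ * Γ) * O (r + 1)

/-- The local weights attached to parameters `a`, `α`, `ρ`, `Γ` and a sequence `O`. -/
def localWeight (a α ρ Γ : ℝ) (O : ℕ → ℝ) : ℕ → Bool → ℕ → ℝ
  | 0, false, r => O r
  | 0, true, r => if r = 0 then a else ρ * α
  | q + 1, h, _ => α * Γ ^ q * (if h then ρ * Γ else 1)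

theorem localWeight_succ_succ (a α ρ Γ : ℝ) (O : ℕ → ℝ) (q : ℕ) (h : Bool) (r : ℕ) :
    localWeight a α ρ Γ O (q + 1 + 1) h r = Γ * localWeight a α ρ Γ O (q + 1) h r := by
  simp only [localWeight]
  ring

namespace Parameters

variable {a α ρ Γ : ℝ} {O : ℕ → ℝ} (H : Parameters a α ρ Γ O)

include H

theorem one_le_alpha : 1 ≤ α := H.one_le_a.trans H.a_le

theorem rho_pos : 0 < ρ := by
  have h := H.rho_eq
  by_contra hn
  nlinarith [sq_nonneg a, sq_nonneg α]

theorem rho_le_one : ρ ≤ 1 := by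
  have h := H.rho_eq
  have h1 := H.one_le_alpha
  have h2 := H.sq_eq
  have h3 := H.a_le
  have h4 := H.one_le_a
  refine le_of_mul_le_mul_right (a := α ^ 2) ?_ (by positivity)
  nlinarith

theorem gamma_one_le : 1 ≤ Γ := by
  have h := H.one_le_kappa
  have h1 := H.rho_pos
  have h2 := H.rho_le_one
  by_contra hn
  nlinarith

theorem a_le_rho_mul : a ≤ ρ * α := by
  have h1 := H.one_le_alpha
  have h2 := H.rho_eq
  have h3 := H.sq_eq
  have h4 := H.a_le
  have h5 := H.one_le_a
  by_contra hn
  nlinarith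

theorem rho_pow_le_one (r : ℕ) : ρ ^ r ≤ 1 := pow_le_one₀ H.rho_pos.le H.rho_le_one

theorem rho_pow_succ_le (r : ℕ) : ρ ^ (r + 1) ≤ ρ := by
  rw [pow_succ]
  exact mul_le_of_le_one_left H.rho_pos.le (H.rho_pow_le_one r)

theorem rho_pow_nonneg (r : ℕ) : 0 ≤ ρ ^ r := pow_nonneg H.rho_pos.le r

theorem one_le_seq (r : ℕ) : 1 ≤ O r := H.zero ▸ H.mono (Nat.zero_le r)

theorem alpha_le_localWeight (q : ℕ) (h : Bool) (r : ℕ) :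
    α ≤ localWeight a α ρ Γ O (q + 1) h r := by
  have h1 := H.one_le_alpha
  have h2 : 1 ≤ Γ ^ q := one_le_pow₀ H.gamma_one_le
  have h3 : (1 : ℝ) ≤ if h then ρ * Γ else 1 := by
    split_ifs
    exacts [H.one_le_kappa, le_rfl]
  simp only [localWeight]
  calc α = α * 1 * 1 := by ring
    _ ≤ _ := by gcongr

/-- This is `full_move` with the light target's weight set to `α`, the least weight of a vertex with
a full heavy in-row, and with `ρ ^ r₂` replaced by `1`. -/
theorem move_from_light (q : ℕ) (h : Bool) (r : ℕ) :
    a * ρ ^ r * α + localWeight a α ρ Γ O q h r ≤ α * localWeight a α ρ Γ O (q + 1) h r := by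
  have hα := H.one_le_alpha
  have ha := H.one_le_a
  have hz := H.rho_pow_le_one r
  have hz0 := H.rho_pow_nonneg r
  rcases q with _ | q
  · rcases h with _ | _
    · have := H.half r
      have h2 := H.sq_eq
      have h3 := H.a_le
      simp only [localWeight]
      simp only [pow_zero, mul_one, Bool.false_eq_true, if_false]
      nlinarith [mul_nonneg (mul_nonneg (by linarith : 0 ≤ a) (sub_nonneg.2 h3)) (sub_nonneg.2 hz)]
    · simp only [localWeight, if_true, pow_zero, mul_one]
      rcases r with _ | r
      · have := H.kappa₁
        simp only [pow_zero, mul_one, if_true]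
        nlinarith
      · have h1 := H.gamma₁
        have h2 := H.rho_pow_succ_le r
        simp only [Nat.succ_ne_zero, if_false]
        have e1 : a * ρ ^ (r + 1) * α ≤ a * ρ * α := by gcongr
        have e2 : α * ρ * (a + 1) ≤ α * ρ * (α * Γ) :=
          mul_le_mul_of_nonneg_left h1 (mul_nonneg (by linarith) H.rho_pos.le)
        nlinarith
  · rw [localWeight_succ_succ]
    have h1 := H.alpha_le_localWeight q h r
    have h2 := H.gamma₁
    have e1 : a * ρ ^ r * α ≤ a * 1 * α := by gcongr
    have e2 := mul_le_mul h1 (by linarith : a ≤ α * Γ - 1) (by linarith) (by linarith)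
    nlinarith

/-- This is `full_move` when the light target has only half heavy in-rows and gains its first light
row, so that its weight rises from `a` to `ρ * α`. For `q = r = 0` and `h = false` it is an
equality, which is what fixes `ρ = (a ^ 2 + 1) / α ^ 2`. -/
theorem move_half (q : ℕ) (h : Bool) (r : ℕ) :
    a ^ 2 * ρ ^ r + localWeight a α ρ Γ O q h r ≤
      localWeight a α ρ Γ O (q + 1) h r * (ρ * α) := by
  have hα := H.one_le_alpha
  have ha := H.one_le_a
  have hz := H.rho_pow_le_one r
  have hρ := H.rho_eq
  rcases q with _ | q
  · rcases h with _ | _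
    · have := H.half r
      simp only [localWeight]
      simp only [pow_zero, mul_one, Bool.false_eq_true, if_false]
      nlinarith
    · simp only [localWeight, if_true, pow_zero, mul_one]
      have e0 : α * (ρ * Γ) * (ρ * α) = ρ * Γ * (a ^ 2 + 1) := by rw [← hρ]; ring
      rw [e0]
      rcases r with _ | r
      · have := H.kappa₂
        simp only [pow_zero, mul_one, if_true]
        nlinarith
      · have h1 := H.kappa₃
        have h2 := H.rho_pow_succ_le r
        simp only [Nat.succ_ne_zero, if_false]
        have e1 : a ^ 2 * ρ ^ (r + 1) ≤ a ^ 2 * ρ := by gcongr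
        have e2 := mul_le_mul_of_nonneg_left h1 H.rho_pos.le
        have e3 : ρ * (ρ * Γ * α ^ 2) = ρ * Γ * (a ^ 2 + 1) := by rw [← hρ]; ring
        nlinarith
  · rw [localWeight_succ_succ]
    have h1 := H.alpha_le_localWeight q h r
    have h2 := H.kappa₃
    have h3 := H.one_le_kappa
    have e1 : a ^ 2 * ρ ^ r ≤ a ^ 2 * 1 := by gcongr
    have h4 : 0 ≤ ρ * Γ * α - 1 := by nlinarith
    have e2 := mul_le_mul_of_nonneg_right h1 h4
    nlinarith

/-- The remaining case of `full_move`: the light target has no heavy in-row, and its weight is given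
by the sequence `O`. -/
theorem move_orphan (q : ℕ) (h : Bool) (r₁ r₂ : ℕ) :
    a * ρ ^ r₁ * O r₂ + ρ ^ r₂ * localWeight a α ρ Γ O q h r₁ ≤
      localWeight a α ρ Γ O (q + 1) h r₁ * O (r₂ + 1) := by
  have hα := H.one_le_alpha
  have ha := H.one_le_a
  have hz := H.rho_pow_le_one r₁
  have hO := H.one_le_seq r₂
  have hy0 := H.rho_pow_nonneg r₂
  have hd := H.double r₂
  rcases q with _ | q
  · rcases h with _ | _
    · simp only [localWeight]
      simp only [pow_zero, mul_one, Bool.false_eq_true, if_false]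
      exact H.light r₁ r₂
    · simp only [localWeight, if_true, pow_zero, mul_one]
      rcases r₁ with _ | r
      · have := H.mixed r₂
        simp only [pow_zero, mul_one, if_true]
        linarith
      · have h2 := H.rho_pow_succ_le r
        simp only [Nat.succ_ne_zero, if_false]
        have e1 : a * ρ ^ (r + 1) * O r₂ ≤ a * ρ * O r₂ := by gcongr
        have e2 := mul_le_mul_of_nonneg_left hd H.rho_pos.le
        nlinarith
  · rw [localWeight_succ_succ]
    have h1 := H.alpha_le_localWeight q h r₁
    have e1 : a * ρ ^ r₁ * O r₂ ≤ a * 1 * O r₂ := by gcongr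
    have h4 : 0 ≤ Γ * O (r₂ + 1) - ρ ^ r₂ := by
      by_contra hn
      nlinarith
    have e2 := mul_le_mul_of_nonneg_right h1 h4
    nlinarith

theorem localWeight_true_zero_le (r : ℕ) : localWeight a α ρ Γ O 0 true r ≤ ρ * α := by
  simp only [localWeight]
  split_ifs
  exacts [H.a_le_rho_mul, le_rfl]

theorem one_le_localWeight (q : ℕ) (h : Bool) (r : ℕ) : 1 ≤ localWeight a α ρ Γ O q h r := by
  rcases q with _ | q
  · rcases h with _ | _
    · exact H.one_le_seq r
    · simp only [localWeight]
      split_ifs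
      exacts [H.one_le_a, H.one_le_a.trans H.a_le_rho_mul]
  · exact H.one_le_alpha.trans (H.alpha_le_localWeight q h r)

/-- The potential attached to a set of parameters. -/
noncomputable def potential : CyclePotential a α where
  ρ := ρ
  g := localWeight a α ρ Γ O
  γ := α / Γ
  Γ := Γ
  rho_nonneg := H.rho_pos.le
  rho_le_one := H.rho_le_one
  one_le := H.one_le_localWeight
  mono := by
    intro q h r
    rcases q with _ | q
    · rcases h with _ | _
      · exact H.mono (Nat.le_succ r)
      · refine (H.localWeight_true_zero_le r).trans ?_
        simp [localWeight]
    · exact le_rfl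
  halve := by
    intro q h r
    have hα := H.one_le_alpha
    have hρ := H.rho_pos
    rcases q with _ | q
    · exact (H.localWeight_true_zero_le r).trans
        (mul_le_mul_of_nonneg_left (H.alpha_le_localWeight 0 h r) hρ.le)
    · rw [localWeight_succ_succ]
      have hΓ := H.gamma_one_le
      have hk := H.one_le_kappa
      have e : α * Γ ^ q ≤ localWeight a α ρ Γ O (q + 1) h r := by
        simp only [localWeight]
        refine le_mul_of_one_le_right (by positivity) ?_
        split_ifs
        exacts [hk, le_rfl]
      calc localWeight a α ρ Γ O (q + 1) true r = ρ * Γ * (α * Γ ^ q) := by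
            simp only [localWeight, if_true]; ring
        _ ≤ ρ * Γ * localWeight a α ρ Γ O (q + 1) h r :=
            mul_le_mul_of_nonneg_left e (by linarith)
        _ = _ := by ring
  half_move := by
    intro q r
    have ha := H.one_le_a
    have hz := H.rho_pow_le_one r
    rcases q with _ | q
    · rcases r with _ | r
      · simp [localWeight]
      · simp only [localWeight, Nat.succ_ne_zero, if_false]
        rw [mul_comm ρ]
        exact mul_le_mul H.a_le (H.rho_pow_succ_le r) (H.rho_pow_nonneg _)
          (by linarith [H.one_le_alpha])
    · refine le_trans ?_ (H.alpha_le_localWeight q true r)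
      exact (mul_le_of_le_one_right (by linarith) hz).trans H.a_le
  full_move := by
    intro q₁ h₁ r₁ q₂ h₂ r₂
    have hw : 0 ≤ localWeight a α ρ Γ O q₁ h₁ r₁ := zero_le_one.trans (H.one_le_localWeight _ _ _)
    have key := H.move_from_light q₁ h₁ r₁
    have hy := H.rho_pow_le_one r₂
    rcases q₂ with _ | q₂
    · rcases h₂ with _ | _
      · exact H.move_orphan q₁ h₁ r₁ r₂
      · rcases r₂ with _ | r₂
        · have := H.move_half q₁ h₁ r₁
          simp only [localWeight, if_true, Nat.succ_ne_zero, if_false, pow_zero, one_mul]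
          simp only [localWeight] at this
          nlinarith
        -- The light target weighs `ρ * α` before and after, and `ρ ^ (r₂ + 1) ≤ ρ`, so the claim is
        -- `ρ` times `move_from_light`.
        · have e1 := mul_le_mul_of_nonneg_left key H.rho_pos.le
          have e2 := mul_le_mul_of_nonneg_right (H.rho_pow_succ_le r₂) hw
          rw [show localWeight a α ρ Γ O 0 true (r₂ + 1) = ρ * α by simp [localWeight],
            show localWeight a α ρ Γ O 0 true (r₂ + 1 + 1) = ρ * α by simp [localWeight]]
          nlinarith
    · have h1 := H.alpha_le_localWeight q₂ h₂ r₂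
      have hα := H.one_le_alpha
      change a * ρ ^ r₁ * localWeight a α ρ Γ O (q₂ + 1) h₂ r₂ +
        ρ ^ r₂ * localWeight a α ρ Γ O q₁ h₁ r₁ ≤ localWeight a α ρ Γ O (q₁ + 1) h₁ r₁ *
          localWeight a α ρ Γ O (q₂ + 1) h₂ r₂
      set X := localWeight a α ρ Γ O q₁ h₁ r₁
      set Y := localWeight a α ρ Γ O (q₂ + 1) h₂ r₂
      set Z := localWeight a α ρ Γ O (q₁ + 1) h₁ r₁
      have e1 : ρ ^ r₂ * X ≤ X := mul_le_of_le_one_left hw hy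
      -- The claim is affine in `Y` with nonnegative slope `Z - a * ρ ^ r₁`, so it suffices to have
      -- it at `Y = α`.
      have e2 : 0 ≤ Z - a * ρ ^ r₁ := by
        by_contra hn
        nlinarith
      nlinarith [mul_le_mul_of_nonneg_left h1 e2]
  init := by
    intro q r
    have hΓ : 0 < Γ := by linarith [H.gamma_one_le]
    rcases q with _ | q
    · rw [pow_zero, mul_one, le_div_iff₀ hΓ]
      exact H.mul_le r
    · simp only [localWeight, Bool.false_eq_true, if_false, mul_one]
      apply le_of_eq
      field_simp
      ring
  mul_eq := div_mul_cancel₀ _ (by linarith [H.gamma_one_le])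

end Parameters
end CyclePotential

/-! ### Numerical parameters: a capped sequence for `k ≥ 3`, the golden ratio for `k = 2`. -/

namespace CyclePotential

/-- Conditions under which the sequence `1, min (b - c * ρ) γ, min (b - c * ρ ^ 2) γ, …` yields
`Parameters`. -/
structure SequenceBounds (a α ρ Γ γ b c O₁ : ℝ) : Prop where
  one_le_a : 1 ≤ a
  a_le : a ≤ α
  sq_eq : α ^ 2 = a * α + 1
  rho_eq : ρ * α ^ 2 = a ^ 2 + 1
  rho_pos : 0 < ρ
  rho_le : ρ ≤ 1
  b_eq : b = O₁ + c * ρ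
  gamma_mul : γ * Γ = α
  gamma_pos : 0 < γ
  gamma_eq : γ * (α + c) = b * α
  one_le_first : 1 ≤ O₁
  one_le_c : 1 ≤ c
  c_le : c ≤ a
  one_le_kappa : 1 ≤ ρ * Γ
  kappa₁ : a * (α + 1) ≤ ρ * Γ * α ^ 2
  kappa₂ : a ^ 2 + a ≤ ρ * Γ * (a ^ 2 + 1)
  kappa₃ : a ^ 2 + α ≤ ρ * Γ * α ^ 2
  gamma₁ : a + 1 ≤ α * Γ
  first_le : O₁ ≤ γ
  half : a ^ 2 * ρ + O₁ ≤ a ^ 2 + 1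
  light₁ : a + 1 ≤ α * O₁
  light₂ : a * ρ + O₁ ≤ α * O₁
  light₃ : α * ρ * (1 + c * (α * ρ - a)) ≤ b
  light₄ : ρ * (O₁ + ρ * c / α) ≤ b * (α - a * ρ)
  light₅ : a * ρ + O₁ / α ≤ α
  light₆ : O₁ ≤ a * ρ * c
  double₁ : a + α ≤ α * Γ * O₁
  double₂ : a * γ + α * ρ ≤ α ^ 2
  double₃ : a * O₁ + α * ρ ≤ α * Γ * (b - c * ρ ^ 2)
  mixed₁ : 2 * a ≤ α * (ρ * Γ) * O₁
  mixed₂ : a * (γ + γ / α) ≤ a ^ 2 + 1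
  mixed₃ : a * O₁ + a * ρ ≤ α * (ρ * Γ) * (b - c * ρ ^ 2)

/-- All parameters are rational functions of `α`: here `a = α - 1 / α`, `c = a - 3 / 4`, `O₁ = 1 + 1
/ a` and `D / (4 * α) = α + c`; the others follow from the equations among the conditions. -/
theorem sequenceBounds_of_eq {α N R C D B : ℝ} (h : 12 / 5 ≤ α) (hN : N = α ^ 2 - 1)
    (hR : R = α ^ 4 - α ^ 2 + 1) (hC : C = 4 * α ^ 2 - 3 * α - 4)
    (hD : D = 8 * α ^ 2 - 3 * α - 4) (hB : B = 4 * α ^ 5 * (N + α) + N * C * R) :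
    SequenceBounds (N / α) α (R / α ^ 4) (D * α ^ 4 * N / B) (B / (D * α ^ 3 * N))
      (B / (4 * α ^ 5 * N)) (C / (4 * α)) ((N + α) / N) := by
  have h0 : 0 < α := by linarith
  have hN0 : 0 < N := by rw [hN]; nlinarith
  have hR0 : 0 < R := by rw [hR]; nlinarith [sq_nonneg (α ^ 2 - 1)]
  have hC0 : 0 < C := by rw [hC]; nlinarith
  have hD0 : 0 < D := by rw [hD]; nlinarith
  have hB0 : 0 < B := by rw [hB]; positivity
  obtain ⟨t, ht, h'⟩ : ∃ t, 0 ≤ t ∧ α = t + 12 / 5 := ⟨α - 12 / 5, by linarith, by ring⟩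
  constructor
  case sq_eq => field_simp; subst hN; ring
  case rho_eq => field_simp; subst hN hR; ring
  case rho_pos => positivity
  case b_eq => field_simp; subst hB; ring
  case gamma_mul => field_simp
  case gamma_pos => positivity
  case gamma_eq => field_simp; subst hC hD; ring
  -- After clearing denominators and substituting `α = t + 12 / 5`, each difference becomes a
  -- polynomial in `t` whose positivity is visible from its coefficients.
  all_goals
    field_simp
    rw [← sub_nonneg]
    subst hB hN hR hC hD h'
    ring_nf
    positivity

/-- The sequence `1, min (b - c * ρ) γ, min (b - c * ρ ^ 2) γ, …`. -/
noncomputable def cappedSeq (ρ γ b c : ℝ) (r : ℕ) : ℝ := if r = 0 then 1 else min (b - c * ρ ^ r) γ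

theorem affine_nonneg {u v y ρ : ℝ} (hρ : 0 < ρ) (hy : 0 ≤ y) (hyρ : y ≤ ρ) (h₀ : 0 ≤ u)
    (h₁ : 0 ≤ u + v * ρ) : 0 ≤ u + v * y := by
  have e : ρ * (u + v * y) = (ρ - y) * u + y * (u + v * ρ) := by ring
  refine nonneg_of_mul_nonneg_right (a := ρ) ?_ hρ
  rw [e]
  exact add_nonneg (mul_nonneg (sub_nonneg.2 hyρ) h₀) (mul_nonneg hy h₁)

namespace SequenceBounds

variable {a α ρ Γ γ b c O₁ : ℝ} (H : SequenceBounds a α ρ Γ γ b c O₁)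

include H

theorem alpha_pos : 0 < α := by linarith [H.one_le_a, H.a_le]

theorem alpha_sub : α - a = 1 / α := by
  have := H.alpha_pos
  have := H.sq_eq
  field_simp
  linarith

/-- The two branches of `min (b - c * y) γ` meet at `y = γ / α`; the case distinctions below are
made at this point. -/
theorem cap_eq : b - c * (γ / α) = γ := by
  have := H.alpha_pos
  have := H.gamma_eq
  field_simp
  linarith

theorem cap_mul : a * γ + γ / α = α * γ := by
  have h := H.alpha_sub
  have : γ / α = γ * (α - a) := by rw [h]; ring
  rw [this]
  ring

theorem b_pos : 0 < b := by
  have h1 := H.b_eq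
  have h2 := mul_pos (zero_lt_one.trans_le H.one_le_c) H.rho_pos
  linarith [H.one_le_first]

/-- The condition `light` for `r₁ = 0`, with `y = ρ ^ r₂` and `r₂ ≥ 1`. If the right side is capped,
the left side is greatest at the crossing `y = γ / α`, because `a * c ≥ 1`; there the bound is
`cap_mul`. -/
theorem light_start {y : ℝ} (hyρ : y ≤ ρ) :
    a * min (b - c * y) γ + y ≤ α * min (b - c * (y * ρ)) γ := by
  have hα := H.alpha_pos
  have ha := H.one_le_a
  have hc := H.one_le_c
  have hb := H.b_pos
  have h1 : a * min (b - c * y) γ ≤ a * γ := by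
    have := min_le_right (b - c * y) γ
    gcongr
  have h2 : a * min (b - c * y) γ ≤ a * (b - c * y) := by
    have := min_le_left (b - c * y) γ
    gcongr
  rcases min_cases (b - c * (y * ρ)) γ with ⟨h, -⟩ | ⟨h, -⟩ <;> rw [h]
  · have e1 : 0 ≤ α * ρ - a := by
      have := H.rho_eq
      have := H.sq_eq
      have := H.a_le
      by_contra hn
      nlinarith
    have e2 : y * (1 + c * (α * ρ - a)) ≤ ρ * (1 + c * (α * ρ - a)) := by gcongr
    have e3 : ρ * (1 + c * (α * ρ - a)) ≤ b / α := by
      rw [le_div_iff₀ hα]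
      linarith [H.light₃]
    have e4 : b / α = b * (α - a) := by rw [H.alpha_sub]; ring
    nlinarith
  · rw [← H.cap_mul]
    rcases le_total y (γ / α) with hy | hy
    · linarith
    · have e1 := H.cap_eq
      have e2 : (1 - a * c) * y ≤ (1 - a * c) * (γ / α) := by
        apply mul_le_mul_of_nonpos_left hy
        nlinarith
      have e3 : a * γ = a * (b - c * (γ / α)) := by rw [e1]
      nlinarith

theorem light_first {y : ℝ} (hyρ : y ≤ ρ) :
    a * ρ * min (b - c * y) γ + y * O₁ ≤ α * min (b - c * (y * ρ)) γ := by
  have hα := H.alpha_pos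
  have ha := H.one_le_a
  have hc := H.one_le_c
  have hρ := H.rho_pos
  have hO := H.one_le_first
  have h1 : a * ρ * min (b - c * y) γ ≤ a * ρ * γ := by
    have := min_le_right (b - c * y) γ
    gcongr
  have h2 : a * ρ * min (b - c * y) γ ≤ a * ρ * (b - c * y) := by
    have := min_le_left (b - c * y) γ
    gcongr
  rcases min_cases (b - c * (y * ρ)) γ with ⟨h, -⟩ | ⟨h, -⟩ <;> rw [h]
  · have e0 : ρ * c / α = ρ * c * (α - a) := by rw [H.alpha_sub]; ring
    have e1 : 0 ≤ O₁ + ρ * c / α := by positivity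
    have e2 := mul_le_mul_of_nonneg_right hyρ e1
    have e3 := H.light₄
    rw [e0] at e2 e3
    nlinarith
  · have e4 : a * ρ * γ + γ / α * O₁ ≤ α * γ := by
      have := mul_le_mul_of_nonneg_left H.light₅ H.gamma_pos.le
      calc _ = γ * (a * ρ + O₁ / α) := by ring
        _ ≤ γ * α := this
        _ = _ := by ring
    rcases le_total y (γ / α) with hy | hy
    · have := mul_le_mul_of_nonneg_right hy (zero_le_one.trans hO)
      linarith
    · have e1 := H.cap_eq
      have e2 : (O₁ - a * ρ * c) * y ≤ (O₁ - a * ρ * c) * (γ / α) :=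
        mul_le_mul_of_nonpos_left hy (sub_nonpos.2 H.light₆)
      have e3 : a * ρ * γ = a * ρ * (b - c * (γ / α)) := by rw [e1]
      nlinarith

theorem double_succ {y : ℝ} (hy : 0 ≤ y) (hyρ : y ≤ ρ) :
    a * min (b - c * y) γ + α * y ≤ α * Γ * min (b - c * (y * ρ)) γ := by
  have hα := H.alpha_pos
  have ha := H.one_le_a
  have hb := H.b_pos
  rcases min_cases (b - c * (y * ρ)) γ with ⟨h, -⟩ | ⟨h, -⟩ <;> rw [h]
  · have h2 : a * min (b - c * y) γ ≤ a * (b - c * y) := by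
      have := min_le_left (b - c * y) γ
      gcongr
    -- With both minima on the branch `b - c * y`, the difference of the sides is affine in `y`, so
    -- the endpoints `0` and `ρ` suffice.
    have h3 := affine_nonneg (u := α * Γ * b - a * b) (v := a * c - α - α * Γ * c * ρ)
      H.rho_pos hy hyρ (by nlinarith [H.gamma₁]) (by
        have h4 := H.double₃
        rw [eq_sub_of_add_eq H.b_eq.symm] at h4
        linarith)
    linarith
  · have h1 : a * min (b - c * y) γ ≤ a * γ := by
      have := min_le_right (b - c * y) γ
      gcongr
    have h2 : α * Γ * γ = α ^ 2 := by rw [mul_assoc, mul_comm Γ, H.gamma_mul, sq]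
    have h3 := mul_le_mul_of_nonneg_left hyρ hα.le
    linarith [H.double₂]

theorem mixed_succ {y : ℝ} (hy : 0 ≤ y) (hyρ : y ≤ ρ) :
    a * min (b - c * y) γ + a * y ≤ α * (ρ * Γ) * min (b - c * (y * ρ)) γ := by
  have hα := H.alpha_pos
  have ha := H.one_le_a
  have hb := H.b_pos
  rcases min_cases (b - c * (y * ρ)) γ with ⟨h, -⟩ | ⟨h, -⟩ <;> rw [h]
  · have h2 : a * min (b - c * y) γ ≤ a * (b - c * y) := by
      have := min_le_left (b - c * y) γ
      gcongr
    have h3 := affine_nonneg (u := α * (ρ * Γ) * b - a * b)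
      (v := a * c - a - α * (ρ * Γ) * c * ρ) H.rho_pos hy hyρ (by
        have : a ≤ α * (ρ * Γ) :=
          H.a_le.trans (le_mul_of_one_le_right hα.le H.one_le_kappa)
        nlinarith) (by
        have h4 := H.mixed₃
        rw [eq_sub_of_add_eq H.b_eq.symm] at h4
        linarith)
    linarith
  · have h2 : α * (ρ * Γ) * γ = a ^ 2 + 1 := by
      rw [← H.rho_eq]
      calc _ = α * ρ * (γ * Γ) := by ring
        _ = _ := by rw [H.gamma_mul]; ring
    rw [h2]
    refine le_trans ?_ H.mixed₂
    rw [← mul_add]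
    refine mul_le_mul_of_nonneg_left ?_ (zero_le_one.trans ha)
    rcases le_total y (γ / α) with h3 | h3
    · have := min_le_right (b - c * y) γ
      linarith
    · have := min_le_left (b - c * y) γ
      have e1 := H.cap_eq
      nlinarith [mul_le_mul_of_nonneg_left h3 (sub_nonneg.2 H.one_le_c)]

/-- As a function of `z`, the left side is nondecreasing up to `γ / α` and affine from there to `ρ`.
The crossing is settled by `double_succ` scaled by `γ / α`, and the end `z = ρ` by `light_first`. -/
theorem light_succ {y z : ℝ} (hy : 0 ≤ y) (hyρ : y ≤ ρ) (hzρ : z ≤ ρ) :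
    a * z * min (b - c * y) γ + y * min (b - c * z) γ ≤ α * min (b - c * (y * ρ)) γ := by
  have hα := H.alpha_pos
  have ha := H.one_le_a
  have hc := H.one_le_c
  have hρ := H.rho_pos
  have hb := H.b_eq
  have hO := H.one_le_first
  have hγ := H.gamma_pos
  set X := min (b - c * y) γ with hX
  have hX0 : 0 ≤ X := le_min (by nlinarith) hγ.le
  set X' := min (b - c * (y * ρ)) γ
  have hcap : a * (γ / α) * X + y * γ ≤ α * X' := by
    have := mul_le_mul_of_nonneg_left (H.double_succ hy hyρ) (div_nonneg hγ.le hα.le)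
    calc a * (γ / α) * X + y * γ = γ / α * (a * X + α * y) := by field_simp
      _ ≤ γ / α * (α * Γ * X') := this
      _ = γ * Γ * X' := by field_simp
      _ = α * X' := by rw [H.gamma_mul]
  rcases le_total z (γ / α) with hz | hz
  · have h1 : y * min (b - c * z) γ ≤ y * γ := by
      have := min_le_right (b - c * z) γ
      gcongr
    have h2 : a * z * X ≤ a * (γ / α) * X := by gcongr
    linarith
  · have h1 : y * min (b - c * z) γ ≤ y * (b - c * z) := by
      have := min_le_left (b - c * z) γ
      gcongr
    rcases le_total 0 (a * X - y * c) with h | h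
    · have h2 := mul_le_mul_of_nonneg_right hzρ h
      have h3 : a * ρ * X + y * O₁ ≤ α * X' := H.light_first hyρ
      have h4 : y * O₁ = y * (b - c * ρ) := by rw [hb]; ring
      nlinarith
    · have h2 := mul_le_mul_of_nonpos_right hz h
      have h4 : y * γ = y * (b - c * (γ / α)) := by rw [H.cap_eq]
      nlinarith

theorem parameters : Parameters a α ρ Γ (cappedSeq ρ γ b c) := by
  have ha := H.one_le_a
  have hα := H.alpha_pos
  have hρ := H.rho_pos
  have hc := H.one_le_c
  have hc' := H.c_le
  have hb := H.b_eq
  have hO := H.one_le_first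
  have hone : cappedSeq ρ γ b c 1 = O₁ := by
    simp only [cappedSeq, one_ne_zero, if_false, pow_one]
    rw [hb, add_sub_cancel_right]
    exact min_eq_left H.first_le
  have hzero : cappedSeq ρ γ b c 0 = 1 := by simp [cappedSeq]
  have hsucc : ∀ r, cappedSeq ρ γ b c (r + 1) = min (b - c * ρ ^ (r + 1)) γ := fun r => by
    simp [cappedSeq]
  have hpow0 : ∀ r : ℕ, 0 ≤ ρ ^ r := fun r => pow_nonneg hρ.le r
  have hpow : ∀ r : ℕ, ρ ^ (r + 1) ≤ ρ := fun r => by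
    rw [pow_succ]
    exact mul_le_of_le_one_left hρ.le (pow_le_one₀ hρ.le H.rho_le)
  have hle : ∀ r, cappedSeq ρ γ b c r ≤ γ := by
    rintro (_ | r)
    · rw [hzero]; linarith [H.first_le]
    · rw [hsucc]; exact min_le_right _ _
  refine ⟨ha, H.a_le, H.sq_eq, H.rho_eq, H.one_le_kappa, H.kappa₁, H.kappa₂, H.kappa₃, H.gamma₁,
    hzero, monotone_nat_of_le_succ ?_, ?_, ?_, ?_, ?_, ?_⟩
  · rintro (_ | r)
    · rw [hzero, hone]; exact hO
    · rw [hsucc, hsucc, pow_succ _ (r + 1)]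
      have : ρ ^ (r + 1) * ρ ≤ ρ ^ (r + 1) := mul_le_of_le_one_right (hpow0 _) H.rho_le
      gcongr
  · intro r
    have hΓ : 0 ≤ Γ := by
      by_contra hn
      nlinarith [H.gamma₁]
    exact (mul_le_mul_of_nonneg_right (hle r) hΓ).trans_eq H.gamma_mul
  · rintro r₁ (_ | r₂)
    · rw [hzero, hone, pow_zero, mul_one, one_mul]
      rcases r₁ with _ | r₁
      · rw [hzero, pow_zero, mul_one]; exact H.light₁
      · rw [hsucc]
        have := min_le_left (b - c * ρ ^ (r₁ + 1)) γ
        nlinarith [H.light₂, mul_le_mul_of_nonneg_left (hpow r₁) (sub_nonneg.2 hc')]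
    · rw [hsucc, hsucc, pow_succ _ (r₂ + 1)]
      rcases r₁ with _ | r₁
      · rw [hzero, pow_zero, mul_one, mul_one]
        exact H.light_start (hpow r₂)
      · rw [hsucc]
        exact H.light_succ (hpow0 _) (hpow r₂) (hpow r₁)
  · rintro (_ | r)
    · rw [hzero, pow_zero, mul_one]
    · rw [hsucc]
      have := min_le_left (b - c * ρ ^ (r + 1)) γ
      have h2 : 0 ≤ a ^ 2 - c := by nlinarith
      nlinarith [H.half, mul_le_mul_of_nonneg_left (hpow r) h2]
  · rintro (_ | r)
    · rw [hzero, hone, pow_zero, mul_one, mul_one]; exact H.double₁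
    · rw [hsucc, hsucc, pow_succ _ (r + 1)]
      exact H.double_succ (hpow0 _) (hpow r)
  · rintro (_ | r)
    · rw [hzero, hone, pow_zero, mul_one, ← two_mul]; exact H.mixed₁
    · rw [hsucc, hsucc, pow_succ _ (r + 1)]
      exact H.mixed_succ (hpow0 _) (hpow r)

end SequenceBounds

/-- Parameters for the golden ratio. -/
theorem parameters_golden {α : ℝ} (h0 : 0 < α) (h : α ^ 2 = α + 1) :
    Parameters 1 α (4 - 2 * α) ((α + 1) / 2) fun r => if r = 0 then 1 else 2 * α - 2 := by
  have l1 : 1618 / 1000 ≤ α := by nlinarith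
  have l2 : α ≤ 16181 / 10000 := by nlinarith
  have hpow0 : ∀ r : ℕ, 0 ≤ (4 - 2 * α) ^ r := fun r => pow_nonneg (by linarith) r
  have hpow : ∀ r : ℕ, (4 - 2 * α) ^ (r + 1) ≤ 4 - 2 * α := fun r => by
    rw [pow_succ]
    exact mul_le_of_le_one_left (by linarith) (pow_le_one₀ (by linarith) (by linarith))
  -- Here `ρ = 2 / α ^ 2` and `Γ = α ^ 2 / 2`, so `ρ * Γ = 1`; the value `2 * α - 2` equals `α / Γ`,
  -- so the sequence is at its cap from index one on.
  have hk : (4 - 2 * α) * ((α + 1) / 2) = 1 := by linarith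
  constructor
  case one_le_a => exact le_rfl
  case a_le => linarith
  case sq_eq => linarith
  case rho_eq => rw [h]; linarith
  case one_le_kappa => rw [hk]
  case kappa₁ => rw [hk]; linarith
  case kappa₂ => rw [hk]; linarith
  case kappa₃ => rw [hk]; linarith
  case gamma₁ => linarith
  case zero => simp
  case mono =>
    refine monotone_nat_of_le_succ ?_
    rintro (_ | r)
    · simp; linarith
    · simp
  case mul_le =>
    rintro (_ | r)
    · simp; linarith
    · simp; linarith
  case light =>
    rintro (_ | r₁) (_ | r₂)
    · simp; linarith
    · have := hpow r₂
      simp; linarith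
    · have := hpow r₁
      simp; linarith
    · have e1 := hpow r₁
      have e2 := hpow r₂
      have e3 := mul_le_mul_of_nonneg_right e1 (by linarith : 0 ≤ 2 * α - 2)
      have e4 := mul_le_mul_of_nonneg_right e2 (by linarith : 0 ≤ 2 * α - 2)
      simp; nlinarith
  case half =>
    rintro (_ | r)
    · simp
    · have := hpow r
      simp; linarith
  case double =>
    rintro (_ | r)
    · have e : α * ((α + 1) / 2) * (2 * α - 2) = α * (α ^ 2 - 1) := by ring
      simp [e, h]; nlinarith
    · have := mul_le_mul_of_nonneg_left (hpow r) h0.le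
      simp; nlinarith
  case mixed =>
    rintro (_ | r)
    · simp [hk]; linarith
    · have := hpow r
      simp [hk]; linarith

end CyclePotential

/-! ### The growth rate and the existence of a potential. -/

theorem cycleGrowth_pos (k : ℕ) : 0 < cycleGrowth k := by
  unfold cycleGrowth
  have h : |(k : ℝ) - 1| < √(((k : ℝ) - 1) ^ 2 + 4) := by
    rw [← Real.sqrt_sq_eq_abs]
    exact Real.sqrt_lt_sqrt (sq_nonneg _) (by linarith)
  have := neg_abs_le ((k : ℝ) - 1)
  linarith

theorem cycleGrowth_sq {k : ℕ} (hk : 1 ≤ k) :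
    cycleGrowth k ^ 2 = ((k - 1 : ℕ) : ℝ) * cycleGrowth k + 1 := by
  unfold cycleGrowth
  push_cast [Nat.cast_sub hk]
  have := Real.sq_sqrt (show 0 ≤ ((k : ℝ) - 1) ^ 2 + 4 by positivity)
  nlinarith

theorem nonempty_cyclePotential {k : ℕ} (hk : 2 ≤ k) :
    Nonempty (CyclePotential ((k - 1 : ℕ) : ℝ) (cycleGrowth k)) := by
  have h0 := cycleGrowth_pos k
  have h1 := cycleGrowth_sq (one_le_two.trans hk)
  rcases hk.eq_or_lt with rfl | hk
  · norm_num at h1 ⊢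
    exact ⟨(CyclePotential.parameters_golden h0 h1).potential⟩
  · have h2 : (2 : ℝ) ≤ ((k - 1 : ℕ) : ℝ) := by exact_mod_cast (by omega : 2 ≤ k - 1)
    have h3 : 12 / 5 ≤ cycleGrowth k := by
      by_contra hn
      nlinarith
    have h4 : ((k - 1 : ℕ) : ℝ) = (cycleGrowth k ^ 2 - 1) / cycleGrowth k := by
      field_simp
      linarith
    rw [h4]
    exact ⟨(CyclePotential.sequenceBounds_of_eq h3 rfl rfl rfl rfl rfl).parameters.potential⟩

/-! ### Reduction of arbitrary rows to two-target rows. -/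

section Rows

variable {V : Type*} [DecidableEq V]

theorem pathCount_update_of_notMem (M : V → V → ℕ) (t : V) (m : V → ℕ) {y : V} (n : ℕ)
    {S : Finset V} {x : V} (hxy : x ≠ y) (hy : y ∉ S ∨ y = t) :
    pathCount (Function.update M y m) t n S x = pathCount M t n S x := by
  induction n generalizing S x with
  | zero => rfl
  | succ n ih =>
    simp only [pathCount, Function.update_of_ne hxy]
    refine Finset.sum_congr rfl fun v hv => ?_
    by_cases hvt : v = t
    · simp [hvt]
    · rw [if_neg hvt, if_neg hvt, ih]
      · rintro rfl
        exact hy.elim (fun h => h hv) hvt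
      · exact hy.imp (fun h h' => h (Finset.mem_of_mem_erase h')) id

/-- The number of paths is an affine function of each row of the weight matrix. -/
theorem exists_pathCount_update_eq (M : V → V → ℕ) {t y : V} (hyt : y ≠ t) (U : Finset V) (n : ℕ)
    {S : Finset V} (hS : S ⊆ U) {x : V} (hx : x = y → y ∉ S) :
    ∃ (c₀ : ℕ) (c : V → ℕ), c y = 0 ∧ ∀ m : V → ℕ,
      pathCount (Function.update M y m) t n S x = c₀ + ∑ w ∈ U, m w * c w := by
  induction n generalizing S x with
  | zero => exact ⟨0, 0, rfl, fun m => by simp [pathCount]⟩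
  | succ n ih =>
    by_cases hxy : x = y
    · have hyS := hx hxy
      subst hxy
      refine ⟨0, fun v => if v ∈ S then (if v = t then 1 else pathCount M t n (S.erase v) v) else 0,
        -- At `y` itself the count is linear in the row, and a loop at `y` contributes nothing
        -- because `y` has already been visited.
        by simp [hyS], fun m => ?_⟩
      simp only [pathCount, Function.update_self, zero_add, mul_ite, mul_zero]
      rw [← Finset.sum_filter, Finset.filter_mem_eq_inter, Finset.inter_eq_right.2 hS]
      refine Finset.sum_congr rfl fun v hv => ?_
      rw [pathCount_update_of_notMem]
      · rintro rfl
        exact hyS hv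
      · exact Or.inl fun h => hyS (Finset.mem_of_mem_erase h)
    · have key : ∀ v, ∃ (c₀ : ℕ) (c : V → ℕ), c y = 0 ∧ ∀ m : V → ℕ,
          pathCount (Function.update M y m) t n (S.erase v) v = c₀ + ∑ w ∈ U, m w * c w :=
        fun v => ih ((Finset.erase_subset _ _).trans hS) (by rintro rfl; simp)
      choose c₀ c hc hm using key
      refine ⟨∑ v ∈ S, M x v * (if v = t then 1 else c₀ v),
        fun w => ∑ v ∈ S, M x v * (if v = t then 0 else c v w), ?_, fun m => ?_⟩
      · simp [hc]
      · simp only [pathCount, Function.update_of_ne hxy, hm]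
        have e : ∀ w, m w * ∑ v ∈ S, M x v * (if v = t then 0 else c v w) =
            ∑ v ∈ S, M x v * (if v = t then 0 else m w * c v w) := fun w => by
          rw [Finset.mul_sum]
          refine Finset.sum_congr rfl fun v _ => ?_
          split_ifs
          · simp
          · ring
        simp only [e]
        rw [Finset.sum_comm, ← Finset.sum_add_distrib]
        refine Finset.sum_congr rfl fun v _ => ?_
        rw [← Finset.mul_sum, ← mul_add]
        split_ifs
        · simp
        · rfl

/-- A row with total at most `a + 1` and entries at most `a`, except possibly at `y`, is dominated
by a row with the two entries `a` and `1`, up to an error at `y`. -/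
theorem exists_row_le {a : ℕ} {U : Finset V} (hU : 2 ≤ U.card) (y : V) (m c : V → ℕ)
    (hm : ∑ v ∈ U, m v ≤ a + 1) (hma : ∀ v, v ≠ y → m v ≤ a) :
    ∃ p ∈ U, ∃ q ∈ U, p ≠ q ∧ ∑ v ∈ U, m v * c v ≤ a * c p + c q + c y := by
  -- The targets `p` and `q` are the best and the second best for `c`. If `p ≠ y`, at most `a` units
  -- can sit at `p` and the rest earn at most `c q`; if `p = y`, all `a + 1` units may sit there,
  -- and `c y` pays for the excess.
  obtain ⟨p, hp, hpmax⟩ := U.exists_max_image c (Finset.card_pos.1 (by omega))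
  obtain ⟨q, hq, hqmax⟩ := (U.erase p).exists_max_image c
    (Finset.card_pos.1 (by rw [Finset.card_erase_of_mem hp]; omega))
  refine ⟨p, hp, q, Finset.mem_of_mem_erase hq, (Finset.ne_of_mem_erase hq).symm, ?_⟩
  by_cases hpy : p = y
  · subst hpy
    calc ∑ v ∈ U, m v * c v ≤ ∑ v ∈ U, m v * c p :=
          Finset.sum_le_sum fun v hv => Nat.mul_le_mul_left _ (hpmax v hv)
      _ = (∑ v ∈ U, m v) * c p := by rw [Finset.sum_mul]
      _ ≤ (a + 1) * c p := Nat.mul_le_mul_right _ hm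
      _ ≤ _ := by rw [add_mul, one_mul]; omega
  · have h1 := hma p hpy
    have h2 := hpmax q (Finset.mem_of_mem_erase hq)
    rw [← Finset.add_sum_erase _ _ hp] at hm ⊢
    have h3 : ∑ v ∈ U.erase p, m v * c v ≤ (∑ v ∈ U.erase p, m v) * c q := by
      rw [Finset.sum_mul]
      exact Finset.sum_le_sum fun v hv => Nat.mul_le_mul_left _ (hqmax v hv)
    have h4 : (∑ v ∈ U.erase p, m v) * c q ≤ (a + 1 - m p) * c q :=
      Nat.mul_le_mul_right _ (by omega)
    obtain ⟨d, rfl⟩ := Nat.exists_eq_add_of_le h1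
    have h5 : m p + d + 1 - m p = d + 1 := by omega
    rw [h5] at h4
    nlinarith [Nat.mul_le_mul_left d h2]

theorem sum_twoStep_mul {a : ℕ} {U : Finset V} {p q : V} (hp : p ∈ U) (hq : q ∈ U) (c : V → ℕ) :
    ∑ v ∈ U, ((if v = p then a else 0) + (if v = q then 1 else 0)) * c v = a * c p + c q := by
  simp [add_mul, Finset.sum_add_distrib, hp, hq]

/-- Rows other than that of `t` are replaced one at a time without loss: the error term in
`exists_row_le` is the coefficient of a loop at `y ≠ t`, which is zero. -/
theorem exists_rows_le {a : ℕ} {U : Finset V} (hU : 2 ≤ U.card) (t : V) (n : ℕ) (M : V → V → ℕ)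
    (hM : ∀ x, ∑ v ∈ U, M x v ≤ a + 1) (hMa : ∀ x v, x ≠ v → M x v ≤ a) (W : Finset V)
    (hW : t ∉ W) :
    ∃ M' : V → V → ℕ, (∀ x ∈ W, ∃ p ∈ U, ∃ q ∈ U, p ≠ q ∧
        M' x = fun v => (if v = p then a else 0) + (if v = q then 1 else 0)) ∧
      (∀ x ∉ W, M' x = M x) ∧ pathCount M t n U t ≤ pathCount M' t n U t := by
  induction W using Finset.induction_on with
  | empty => exact ⟨M, by simp, fun _ _ => rfl, le_rfl⟩
  | insert y W hy ih =>
    rw [Finset.mem_insert, not_or] at hW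
    obtain ⟨M', h1, h2, h3⟩ := ih hW.2
    obtain ⟨c₀, c, hc, hm⟩ := exists_pathCount_update_eq M' (Ne.symm hW.1) U n subset_rfl
      (x := t) (fun h => absurd h hW.1)
    obtain ⟨p, hp, q, hq, hpq, hle⟩ := exists_row_le hU y (M y) c (hM y)
      (fun v hv => hMa y v hv.symm)
    refine ⟨Function.update M' y fun v => (if v = p then a else 0) + (if v = q then 1 else 0),
      ?_, ?_, ?_⟩
    · intro x hx
      by_cases hxy : x = y
      · subst hxy
        exact ⟨p, hp, q, hq, hpq, Function.update_self _ _ _⟩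
      · rw [Function.update_of_ne hxy]
        exact h1 x ((Finset.mem_insert.1 hx).resolve_left hxy)
    · intro x hx
      rw [Finset.mem_insert, not_or] at hx
      rw [Function.update_of_ne hx.1, h2 x hx.2]
    · refine h3.trans ?_
      have e := hm (M' y)
      rw [Function.update_eq_self, h2 y hy] at e
      rw [e, hm, sum_twoStep_mul hp hq]
      rw [hc] at hle
      omega

/-- The row of `t` is used only in the first step. A loop at `t` is a complete closed path, so its
coefficient is `1`, and this is the additive error. -/
theorem exists_twoStep_le [Fintype V] {a : ℕ} {U : Finset V} (hU : 2 ≤ U.card) (t : V) (n : ℕ)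
    (M : V → V → ℕ) (hM : ∀ x, ∑ v ∈ U, M x v ≤ a + 1) (hMa : ∀ x v, x ≠ v → M x v ≤ a) :
    ∃ p q : V → V, (∀ y, p y ≠ q y) ∧ (∀ y, p y ∈ U) ∧ (∀ y, q y ∈ U) ∧
      pathCount M t n U t ≤ pathCount (twoStep a p q) t n U t + 1 := by
  obtain ⟨M', h1, h2, h3⟩ := exists_rows_le hU t n M hM hMa (Finset.univ.erase t) (by simp)
  rcases n with _ | n
  · obtain ⟨p, hp, q, hq, hpq⟩ := Finset.one_lt_card.1 hU
    exact ⟨fun _ => p, fun _ => q, fun _ => hpq, fun _ => hp, fun _ => hq, by simp [pathCount]⟩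
  obtain ⟨p₀, hp₀, q₀, hq₀, hpq₀, hle⟩ := exists_row_le hU t (M t)
    (fun v => if v = t then 1 else pathCount M' t n (U.erase v) v) (hM t)
    (fun v hv => hMa t v hv.symm)
  have key : ∀ x, ∃ p ∈ U, ∃ q ∈ U, p ≠ q ∧
      Function.update M' t (fun v => (if v = p₀ then a else 0) + (if v = q₀ then 1 else 0)) x =
        fun v => (if v = p then a else 0) + (if v = q then 1 else 0) := by
    intro x
    by_cases hx : x = t
    · subst hx
      exact ⟨p₀, hp₀, q₀, hq₀, hpq₀, Function.update_self _ _ _⟩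
    · rw [Function.update_of_ne hx]
      exact h1 x (by simp [hx])
  choose p hp q hq hpq hrow using key
  refine ⟨p, q, hpq, hp, hq, h3.trans ?_⟩
  have e : twoStep a p q =
      Function.update M' t (fun v => (if v = p₀ then a else 0) + (if v = q₀ then 1 else 0)) :=
    funext fun x => (hrow x).symm
  have e2 : ∀ v, (if v = t then 1 else pathCount (Function.update M' t fun v =>
      (if v = p₀ then a else 0) + (if v = q₀ then 1 else 0)) t n (U.erase v) v) =
        if v = t then 1 else pathCount M' t n (U.erase v) v := by
    intro v
    split_ifs with h
    · rfl
    · rw [pathCount_update_of_notMem _ _ _ _ h (Or.inr rfl)]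
  rw [e]
  simp only [pathCount, Function.update_self, e2]
  rw [sum_twoStep_mul hp₀ hq₀, h2 t (by simp)]
  simpa using hle

theorem pathCount_le [Fintype V] {a : ℕ} {α : ℝ} (P : CyclePotential a α) (haα : (a : ℝ) ≤ α)
    {U : Finset V} {t : V} (ht : t ∈ U) (n : ℕ) (M : V → V → ℕ)
    (hM : ∀ x, ∑ v ∈ U, M x v ≤ a + 1) (hMa : ∀ x v, x ≠ v → M x v ≤ a) :
    (pathCount M t n U t : ℝ) ≤ α ^ U.card + 1 := by
  rcases le_or_gt 2 U.card with hU | hU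
  · obtain ⟨p, q, hpq, hp, hq, h⟩ := exists_twoStep_le hU t n M hM hMa
    have h2 := P.pathCount_twoStep_le p q rfl hpq n ht (fun y _ => hp y) (fun y _ => hq y)
    have h3 : (pathCount M t n U t : ℝ) ≤ (pathCount (twoStep a p q) t n U t : ℝ) + 1 := by
      exact_mod_cast h
    linarith
  · have hU1 : U = {t} := by
      obtain ⟨x, rfl⟩ := Finset.card_eq_one.1
        (show U.card = 1 by have := Finset.card_pos.2 ⟨t, ht⟩; omega)
      rw [Finset.mem_singleton.1 ht]
    subst hU1
    have h1 : pathCount M t n {t} t ≤ a + 1 := by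
      rcases n with _ | n
      · simp [pathCount]
      · have := hM t
        simpa [pathCount] using this
    have h2 : (pathCount M t n {t} t : ℝ) ≤ (a : ℝ) + 1 := by exact_mod_cast h1
    rw [Finset.card_singleton, pow_one]
    linarith

end Rows

/-! ### Cycles as closed paths from their least vertex. -/

namespace MultiDigraph

section Paths

variable {V : Type*} [DecidableEq V]

/-- The lists of at most `n` consecutive edges which lead from `x` to the first visit to `t` and
whose terminal vertices are distinct members of `S`. -/
def paths (G : MultiDigraph V) (t : V) : ℕ → Finset V → V → Finset (List G.Edge)
  | 0, _, _ => ∅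
  | n + 1, S, x => S.biUnion fun v => Finset.univ.biUnion fun i : Fin (G.mult x v) =>
      (if v = t then {[]} else paths G t n (S.erase v) v).image (List.cons ⟨(x, v), i⟩)

theorem card_paths (G : MultiDigraph V) (t : V) (n : ℕ) (S : Finset V) (x : V) :
    (G.paths t n S x).card = pathCount G.mult t n S x := by
  induction n generalizing S x with
  | zero => rfl
  | succ n ih =>
    have hd : ∀ (e f : G.Edge) (A B : Finset (List G.Edge)), e ≠ f →
        Disjoint (A.image (List.cons e)) (B.image (List.cons f)) := by
      intro e f A B hef
      rw [Finset.disjoint_left]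
      intro l hl hl'
      obtain ⟨l₁, -, rfl⟩ := Finset.mem_image.1 hl
      obtain ⟨l₂, -, h⟩ := Finset.mem_image.1 hl'
      exact hef (List.cons.inj h).1.symm
    rw [paths, pathCount, Finset.card_biUnion]
    · refine Finset.sum_congr rfl fun v _ => ?_
      rw [Finset.card_biUnion]
      · simp only [Finset.card_image_of_injective _ List.cons_injective, Finset.sum_const,
          Finset.card_univ, Fintype.card_fin, smul_eq_mul]
        split_ifs
        · rfl
        · rw [ih]
      · intro i _ j _ hij
        exact hd _ _ _ _ fun h => hij (by simpa using h)
    · intro v _ w _ hvw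
      refine (Finset.disjoint_biUnion_left _ _ _).2 ?_
      intro i _
      rw [Finset.disjoint_biUnion_right]
      intro j _
      refine hd _ _ _ _ fun h => hvw ?_
      exact congrArg (fun e : G.Edge => e.1.2) h

/-- One list equation encodes the start at `x`, the chaining of edges and the end at `t`. Distinct
targets in `S` force length at most `S.card`, so the bound `n` on the number of steps excludes
nothing. -/
theorem mem_paths (G : MultiDigraph V) (t : V) {n : ℕ} {S : Finset V} (hn : S.card ≤ n) (x : V)
    (l : List G.Edge) :
    l ∈ G.paths t n S x ↔ l ≠ [] ∧ x :: l.map G.tgt = l.map G.src ++ [t] ∧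
      (l.map G.tgt).Nodup ∧ ∀ v ∈ l.map G.tgt, v ∈ S := by
  induction n generalizing S x l with
  | zero =>
    obtain rfl := Finset.card_eq_zero.1 (Nat.le_zero.1 hn)
    rcases l with _ | ⟨e, l⟩
    · simp [paths]
    · simp only [paths, Finset.notMem_empty, false_iff]
      exact fun h => h.2.2.2 (G.tgt e) (by simp)
  | succ n ih =>
    rcases l with _ | ⟨⟨⟨y, v⟩, i⟩, l⟩
    · simp [paths]
    have key : (⟨(y, v), i⟩ :: l : List G.Edge) ∈ G.paths t (n + 1) S x ↔
        y = x ∧ v ∈ S ∧ l ∈ (if v = t then {[]} else paths G t n (S.erase v) v) := by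
      simp only [paths, Finset.mem_biUnion, Finset.mem_univ, true_and, Finset.mem_image,
        List.cons.injEq]
      constructor
      · rintro ⟨w, hw, j, m, hm, he, rfl⟩
        have h1 := congrArg Sigma.fst he
        simp only [Prod.mk.injEq] at h1
        obtain ⟨rfl, rfl⟩ := h1
        exact ⟨rfl, hw, hm⟩
      · rintro ⟨rfl, hv, hm⟩
        exact ⟨v, hv, i, l, hm, rfl, rfl⟩
    rw [key]
    simp only [List.map_cons, src, tgt, List.cons_append, List.cons.injEq, List.nodup_cons,
      List.forall_mem_cons, ne_eq, reduceCtorEq, not_false_eq_true, true_and]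
    by_cases hv : v ∈ S
    · split_ifs with hvt
      · subst hvt
        rcases l with _ | ⟨e, l⟩
        · simp [hv, eq_comm]
        -- A path continuing after reaching `t` would have `t` twice among its targets, since it
        -- also ends there.
        · simp only [Finset.mem_singleton, reduceCtorEq, and_false, false_iff]
          rintro ⟨⟨-, h⟩, ⟨h2, -⟩, -⟩
          apply h2
          have h3 : v ∈ (v :: List.map G.tgt (e :: l)).getLast? := by
            rw [h, List.getLast?_concat]; rfl
          rw [List.map_cons, List.getLast?_cons_cons] at h3
          exact List.mem_of_getLast? h3
      · rw [ih (by rw [Finset.card_erase_of_mem hv]; omega)]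
        constructor
        · rintro ⟨h0, h1, -, h2, h3, h4⟩
          refine ⟨⟨h0.symm, h2⟩, ⟨fun h => ?_, h3⟩, hv, fun w hw => Finset.mem_of_mem_erase (h4 w hw)⟩
          simpa using h4 v h
        · rintro ⟨⟨h0, h2⟩, ⟨h5, h3⟩, -, h4⟩
          refine ⟨h0.symm, hv, ?_, h2, h3, fun w hw => Finset.mem_erase.2 ⟨?_, h4 w hw⟩⟩
          · rintro rfl
            simp at h2
            exact hvt h2
          · rintro rfl
            exact h5 hw
    · simp [hv]

end Paths

variable {V : Type*}

theorem isChain_iff_map (G : MultiDigraph V) (a : G.Edge) (m : List G.Edge) (b : G.Edge) :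
    List.IsChain (fun e f => G.tgt e = G.src f) (a :: (m ++ [b])) ↔
      (a :: m).map G.tgt = (m ++ [b]).map G.src := by
  induction m generalizing a with
  | nil => simp
  | cons c m ih =>
    rw [List.cons_append, List.isChain_cons_cons, ih]
    simp

theorem isDirectedCycle_coe_cons (G : MultiDigraph V) (e : G.Edge) (m : List G.Edge) :
    G.IsDirectedCycle (e :: m : List G.Edge) ↔
      G.src e :: (e :: m).map G.tgt = (e :: m).map G.src ++ [G.src e] ∧
        ((e :: m).map G.tgt).Nodup := by
  have h1 : G.src e :: (e :: m).map G.tgt = (e :: m).map G.src ++ [G.src e] ↔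
      (e :: m).map G.tgt = (m ++ [e]).map G.src := by
    simp
  rw [IsDirectedCycle, Cycle.chain_coe_cons, isChain_iff_map, h1]
  constructor
  · rintro ⟨-, h, h2⟩
    refine ⟨h, ?_⟩
    rw [h]
    rw [Cycle.map_coe, Cycle.nodup_coe_iff] at h2
    refine (List.Perm.nodup_iff ?_).1 h2
    exact (List.perm_append_singleton e m).symm.map _
  · rintro ⟨h, h2⟩
    refine ⟨by simp [Cycle.coe_eq_nil], h, ?_⟩
    rw [Cycle.map_coe, Cycle.nodup_coe_iff]
    rw [h] at h2
    refine (List.Perm.nodup_iff ?_).2 h2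
    exact (List.perm_append_singleton e m).symm.map _

/-- Each cycle has exactly one rotation whose first edge leaves its least vertex, because no vertex
is repeated; the lists of this kind are counted by their starting vertex. -/
theorem numCycles_eq_sum_pathCount {n : ℕ} (G : MultiDigraph (Fin n)) :
    G.numCycles = ∑ i : Fin n, pathCount G.mult i n (Finset.Ici i) i := by
  classical
  have hmem : ∀ (i : Fin n) (l : List G.Edge), l ∈ G.paths i n (Finset.Ici i) i ↔
      ∃ e m, l = e :: m ∧ G.src e = i ∧ G.IsDirectedCycle (l : Cycle G.Edge) ∧
        ∀ f ∈ l, i ≤ G.src f := by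
    intro i l
    rw [mem_paths _ _ ((Finset.card_le_univ _).trans_eq (Fintype.card_fin n))]
    have hperm : ∀ e m, G.src e :: (e :: m).map G.tgt = (e :: m).map G.src ++ [G.src e] →
        ∀ v, v ∈ (e :: m).map G.tgt ↔ v ∈ (e :: m).map G.src := by
      intro e m h v
      have h2 : (G.src e :: (e :: m).map G.tgt).Perm (G.src e :: (e :: m).map G.src) := by
        rw [h]; exact List.perm_append_singleton _ _
      exact ((List.perm_cons _).1 h2).mem_iff
    constructor
    · rintro ⟨h0, h1, h2, h3⟩
      obtain ⟨e, m, rfl⟩ := List.exists_cons_of_ne_nil h0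
      have hi : G.src e = i := by simp at h1; exact h1.1.symm
      subst hi
      refine ⟨e, m, rfl, rfl, (G.isDirectedCycle_coe_cons e m).2 ⟨h1, h2⟩, fun f hf => ?_⟩
      exact Finset.mem_Ici.1 (h3 _ ((hperm e m h1 _).2 (List.mem_map_of_mem hf)))
    · rintro ⟨e, m, rfl, rfl, hc, h⟩
      obtain ⟨h1, h2⟩ := (G.isDirectedCycle_coe_cons e m).1 hc
      refine ⟨by simp, h1, h2, fun v hv => ?_⟩
      obtain ⟨f, hf, rfl⟩ := List.mem_map.1 ((hperm e m h1 _).1 hv)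
      exact Finset.mem_Ici.2 (h f hf)
  set T : Finset (List G.Edge) :=
    Finset.univ.biUnion fun i : Fin n => G.paths i n (Finset.Ici i) i with hT
  have hcard : T.card = ∑ i : Fin n, pathCount G.mult i n (Finset.Ici i) i := by
    rw [hT, Finset.card_biUnion]
    · exact Finset.sum_congr rfl fun i _ => card_paths _ _ _ _ _
    · intro i _ j _ hij
      refine Finset.disjoint_left.2 ?_
      intro l hl hl'
      obtain ⟨e, m, rfl, rfl, -⟩ := (hmem i l).1 hl
      obtain ⟨e', m', h, rfl, -⟩ := (hmem j _).1 hl'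
      exact hij (by rw [(List.cons.inj h).1])
  have hTmem : ∀ l : List G.Edge, l ∈ T ↔ ∃ e m, l = e :: m ∧
      G.IsDirectedCycle (l : Cycle G.Edge) ∧ ∀ f ∈ l, G.src e ≤ G.src f := by
    intro l
    simp only [hT, Finset.mem_biUnion, Finset.mem_univ, true_and, hmem]
    constructor
    · rintro ⟨_, e, m, h1, rfl, h2⟩
      exact ⟨e, m, h1, h2⟩
    · rintro ⟨e, m, h1, h2⟩
      exact ⟨_, e, m, h1, rfl, h2⟩
  have hTc : ∀ l ∈ T, G.IsDirectedCycle (l : Cycle G.Edge) := by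
    intro l hl
    obtain ⟨e, m, -, h, -⟩ := (hTmem l).1 hl
    exact h
  rw [← hcard, numCycles]
  have hT' : Nat.card T = T.card := by rw [Nat.card_eq_fintype_card, Fintype.card_coe]
  rw [← hT']
  refine (Nat.card_eq_of_bijective (fun l : T =>
    (⟨(l.1 : Cycle G.Edge), hTc l.1 l.2⟩ : {c : Cycle G.Edge // G.IsDirectedCycle c})) ?_).symm
  · constructor
    · rintro ⟨l, hl⟩ ⟨l', hl'⟩ h
      have hr : l ~r l' := Cycle.coe_eq_coe.1 (congrArg Subtype.val h)
      obtain ⟨e, m, he, hc, hmin⟩ := (hTmem l).1 hl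
      obtain ⟨e', m', he', hc', hmin'⟩ := (hTmem l').1 hl'
      have hs : G.src e = G.src e' :=
        le_antisymm (hmin _ (hr.mem_iff.2 (by simp [he']))) (hmin' _ (hr.mem_iff.1 (by simp [he])))
      have hnd : (l.map G.src).Nodup := hc.2.2
      obtain ⟨k, hk, hrot⟩ := List.isRotated_iff_mod.1 hr
      rw [List.rotate_eq_drop_append_take hk] at hrot
      have hlk := List.take_append_drop k l
      refine Subtype.ext ?_
      show l = l'
      -- If the rotation were nontrivial, the first edges of both pieces would leave the same least
      -- vertex, against distinctness of the sources.
      rcases hA : l.take k with _ | ⟨a, A⟩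
      · rw [hA] at hlk hrot
        rw [← hrot, List.append_nil]
        exact hlk.symm
      rcases hB : l.drop k with _ | ⟨b, B⟩
      · rw [hB] at hlk hrot
        rw [← hrot, List.nil_append, List.append_nil] at *
        exact hlk.symm
      rw [hA, hB] at hlk hrot
      have ha : a = e := by rw [he] at hlk; exact (List.cons.inj hlk).1
      have hb : b = e' := by rw [he'] at hrot; exact (List.cons.inj hrot).1
      subst ha hb
      rw [← hlk, List.cons_append, List.map_cons, List.nodup_cons] at hnd
      exact absurd (by simp [hs]) hnd.1
    · rintro ⟨c, hc⟩
      induction c using Quotient.inductionOn' with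
      | _ l =>
        have hl : l ≠ [] := by
          rintro rfl
          exact hc.1 rfl
        obtain ⟨e, hel, hmin⟩ := l.toFinset.exists_min_image G.src
          (by simpa [List.toFinset_nonempty_iff] using hl)
        simp only [List.mem_toFinset] at hel hmin
        obtain ⟨A, B, rfl⟩ := List.append_of_mem hel
        have hr : (A ++ e :: B) ~r (e :: (B ++ A)) := by
          simpa using List.isRotated_append (l := A) (l' := e :: B)
        have heq : ((A ++ e :: B : List G.Edge) : Cycle G.Edge) = (e :: (B ++ A) : List G.Edge) :=
          Cycle.coe_eq_coe.2 hr
        refine ⟨⟨e :: (B ++ A), (hTmem _).2 ⟨e, _, rfl, ?_, fun f hf => hmin f (hr.mem_iff.2 hf)⟩⟩,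
          Subtype.ext heq.symm⟩
        rw [← heq]
        exact hc

end MultiDigraph

/-! ### Bounds on the growth rate and summation over least vertices. -/

section CycleGrowth

theorem one_point_six_le_cycleGrowth {k : ℕ} (hk : 2 ≤ k) : (1.6 : ℝ) ≤ cycleGrowth k := by
  have h := cycleGrowth_sq (k := k) (by omega)
  have h0 := cycleGrowth_pos k
  have h1 : (1 : ℝ) ≤ ((k - 1 : ℕ) : ℝ) := by exact_mod_cast (by omega : 1 ≤ k - 1)
  nlinarith

theorem natCast_pred_le_cycleGrowth {k : ℕ} (hk : 1 ≤ k) : ((k - 1 : ℕ) : ℝ) ≤ cycleGrowth k := by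
  have h := cycleGrowth_sq hk
  have h0 := cycleGrowth_pos k
  nlinarith

theorem cycleGrowth_le {k : ℕ} (hk : 2 ≤ k) : cycleGrowth k ≤ ((k - 1 : ℕ) : ℝ) + 1 := by
  have h := cycleGrowth_sq (k := k) (by omega)
  have h0 := one_point_six_le_cycleGrowth hk
  nlinarith

end CycleGrowth

namespace MultiDigraph

theorem sum_range_pow_add_one_le {α : ℝ} (hα : 1.6 ≤ α) (n : ℕ) :
    ∑ j ∈ Finset.range n, (α ^ (j + 1) + 1) ≤ 5 * α ^ n := by
  induction n with
  | zero => simp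
  | succ n ih =>
    have h1 : 1 ≤ α ^ n := one_le_pow₀ (by linarith)
    rw [Finset.sum_range_succ, pow_succ]
    nlinarith

theorem numCycles_le {n k : ℕ} (hk : 2 ≤ k) {G : MultiDigraph (Fin n)}
    (hG : G ∈ multiClass n k) : (G.numCycles : ℝ) ≤ 5 * cycleGrowth k ^ n := by
  obtain ⟨P⟩ := nonempty_cyclePotential hk
  rw [numCycles_eq_sum_pathCount, Nat.cast_sum]
  have h : ∀ i : Fin n, (pathCount G.mult i n (Finset.Ici i) i : ℝ) ≤
      cycleGrowth k ^ (n - (i : ℕ)) + 1 := by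
    intro i
    have h := pathCount_le P (natCast_pred_le_cycleGrowth (by omega)) (U := Finset.Ici i) (t := i)
      (by simp) n G.mult (fun x => ?_) hG.2
    · rwa [Fin.card_Ici] at h
    · calc ∑ v ∈ Finset.Ici i, G.mult x v ≤ ∑ v, G.mult x v :=
            Finset.sum_le_sum_of_subset (Finset.subset_univ _)
        _ = k - 1 + 1 := by rw [hG.1]; omega
  refine (Finset.sum_le_sum fun i _ => h i).trans ?_
  rw [Fin.sum_univ_eq_sum_range (fun i => cycleGrowth k ^ (n - i) + 1) n,
    ← Finset.sum_range_reflect]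
  refine le_trans (Finset.sum_le_sum fun j hj => ?_)
    (sum_range_pow_add_one_le (one_point_six_le_cycleGrowth hk) n)
  rw [Finset.mem_range] at hj
  rw [show n - (n - 1 - j) = j + 1 by omega]

theorem maxCycles_le {k : ℕ} (hk : 2 ≤ k) (n : ℕ) :
    (maxCycles k n : ℝ) ≤ 5 * cycleGrowth k ^ n := by
  obtain ⟨G, hG, h⟩ := (isGreatest_maxCycles k n).1
  rw [← h]
  exact numCycles_le hk hG

/-! ### The lower bound from the circulant digraph. -/

section Circulant

theorem sub_modEq_iff {n d x v : ℕ} (hd : d ≤ n) (hx : x < n) (hv : v < n) :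
    (v : ℤ) - x ≡ d [ZMOD n] ↔ v = x + d ∨ v + n = x + d := by
  rw [Int.modEq_iff_dvd]
  constructor
  · rintro ⟨c, hc⟩
    have h1 : c < 2 := by
      by_contra hcon
      have : (n : ℤ) * 2 ≤ n * c := by gcongr; omega
      omega
    have h2 : -1 < c := by
      by_contra hcon
      have : (n : ℤ) * c ≤ n * (-1) := by gcongr; omega
      omega
    obtain rfl | rfl : c = 0 ∨ c = 1 := by omega
    · left; omega
    · right; omega
  · rintro (h | h)
    · exact ⟨0, by subst h; push_cast; ring⟩
    · exact ⟨1, by have : (v : ℤ) + n = x + d := by exact_mod_cast h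
                   linarith⟩

theorem circulant_mult {n k : ℕ} (hn : 3 ≤ n) (x v : Fin n) :
    (circulant n k).mult x v =
      (if (v : ℕ) = x + 1 ∨ (v : ℕ) + n = x + 1 then k - 1 else 0) +
        if (v : ℕ) = x + 2 ∨ (v : ℕ) + n = x + 2 then 1 else 0 := by
  have h1 := sub_modEq_iff (d := 1) (by omega) x.2 v.2
  have h2 := sub_modEq_iff (d := 2) (by omega) x.2 v.2
  push_cast at h1 h2
  simp only [circulant, h1, h2]
  split_ifs <;> first | rfl | omega

theorem circulant_mem_multiClass {n k : ℕ} (hn : 3 ≤ n) (hk : 2 ≤ k) :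
    circulant n k ∈ multiClass n k := by
  have hw : ∀ (x : Fin n) (d : ℕ), d ≤ n → ∃ w : Fin n, ∀ v : Fin n,
      ((v : ℕ) = x + d ∨ (v : ℕ) + n = x + d) ↔ v = w := by
    intro x d hd
    rcases lt_or_ge (x + d : ℕ) n with h | h
    · exact ⟨⟨x + d, h⟩, fun v => by rw [Fin.ext_iff]; simp only; omega⟩
    · exact ⟨⟨x + d - n, by omega⟩, fun v => by rw [Fin.ext_iff]; simp only; omega⟩
  constructor
  · intro x
    obtain ⟨w₁, h1⟩ := hw x 1 (by omega)
    obtain ⟨w₂, h2⟩ := hw x 2 (by omega)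
    simp only [circulant_mult hn, Finset.sum_add_distrib, h1, h2, Finset.sum_ite_eq',
      Finset.mem_univ, if_true]
    omega
  · intro x v _
    rw [circulant_mult hn]
    split_ifs <;> omega

/-- The sequence `1, a, a² + 1, …` with `u (m + 2) = a u (m + 1) + u m`. -/
def lucasSeq (a : ℕ) : ℕ → ℕ
  | 0 => 1
  | 1 => a
  | m + 2 => a * lucasSeq a (m + 1) + lucasSeq a m

theorem lucasSeq_add {a : ℕ} {α β : ℝ} (hα : α ^ 2 = a * α + 1) (hβ : β ^ 2 = a * β + 1)
    (h : α + β = a) (m : ℕ) :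
    ((lucasSeq a (m + 2) + lucasSeq a m : ℕ) : ℝ) = α ^ (m + 2) + β ^ (m + 2) := by
  induction m using Nat.twoStepInduction with
  | zero =>
    simp only [lucasSeq]
    push_cast
    rw [hα, hβ, ← h]
    ring
  | one =>
    simp only [lucasSeq]
    push_cast
    have e : α ^ (1 + 2) + β ^ (1 + 2) = a * (α ^ 2 + β ^ 2) + (α + β) := by
      linear_combination α * hα + β * hβ
    rw [e, hα, hβ]
    linear_combination (-(a : ℝ) ^ 2 - 1) * h
  | more m ih1 ih2 =>
    have e : lucasSeq a (m + 2 + 2) + lucasSeq a (m + 2) =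
        a * (lucasSeq a (m + 1 + 2) + lucasSeq a (m + 1)) +
          (lucasSeq a (m + 2) + lucasSeq a m) := by
      simp only [lucasSeq]
      ring
    rw [e, Nat.cast_add, Nat.cast_mul, ih1, ih2]
    linear_combination (-α ^ (m + 2)) * hα + (-β ^ (m + 2)) * hβ

section Steps

variable {V : Type*} [DecidableEq V] {M : V → V → ℕ} {t : V} {m : ℕ} {S : Finset V} {x : V}

theorem mul_le_pathCount {v : V} (hv : v ∈ S) :
    M x v * (if v = t then 1 else pathCount M t m (S.erase v) v) ≤ pathCount M t (m + 1) S x :=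
  Finset.single_le_sum
    (f := fun v => M x v * (if v = t then 1 else pathCount M t m (S.erase v) v))
    (fun _ _ => Nat.zero_le _) hv

theorem mul_add_mul_le_pathCount {v w : V} (hv : v ∈ S) (hw : w ∈ S) (hvw : v ≠ w) :
    M x v * (if v = t then 1 else pathCount M t m (S.erase v) v) +
      M x w * (if w = t then 1 else pathCount M t m (S.erase w) w) ≤
        pathCount M t (m + 1) S x := by
  rw [← Finset.sum_pair
    (f := fun v => M x v * (if v = t then 1 else pathCount M t m (S.erase v) v)) hvw]
  exact Finset.sum_le_sum_of_subset (by simp [Finset.insert_subset_iff, hv, hw])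

end Steps

variable {n k : ℕ}

theorem circulant_mult_one (hn : 3 ≤ n) {x v : Fin n}
    (h : (v : ℕ) = x + 1 ∨ (v : ℕ) + n = x + 1) : (circulant n k).mult x v = k - 1 := by
  rw [circulant_mult hn, if_pos h, if_neg (by omega), add_zero]

theorem circulant_mult_two (hn : 3 ≤ n) {x v : Fin n}
    (h : (v : ℕ) = x + 2 ∨ (v : ℕ) + n = x + 2) : (circulant n k).mult x v = 1 := by
  rw [circulant_mult hn, if_neg (by omega), if_pos h, zero_add]

/-- Only paths climbing from `p` and landing exactly on `v_0` after total advance `d` are kept;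
splitting off the first step gives the recursion. -/
theorem lucasSeq_le_pathCount_zero (hn : 3 ≤ n) {z : Fin n} (hz : (z : ℕ) = 0) (d : ℕ) :
    ∀ (p : Fin n) (m : ℕ) (S : Finset (Fin n)), (p : ℕ) + d = n → d ≤ m → z ∈ S →
      (∀ v, p < v → v ∈ S) →
        lucasSeq (k - 1) d ≤ pathCount (circulant n k).mult z m S p := by
  induction d using Nat.strong_induction_on with
  | _ d ih =>
    intro p m S hp hm hzS hS
    obtain ⟨m, rfl⟩ : ∃ m', m = m' + 1 := ⟨m - 1, by have := p.2; omega⟩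
    rcases d with _ | _ | d
    · have := p.2
      omega
    · refine le_trans (le_of_eq ?_) (mul_le_pathCount hzS)
      rw [circulant_mult_one hn (by omega), if_pos rfl, mul_one]
      rfl
    · have hv : (⟨p + 1, by omega⟩ : Fin n) ∈ S := hS _ (Fin.lt_def.2 (by simp))
      have hvz : (⟨p + 1, by omega⟩ : Fin n) ≠ z := by
        rw [ne_eq, Fin.ext_iff]; simp only; omega
      have h1 := ih (d + 1) (by omega) ⟨p + 1, by omega⟩ m (S.erase ⟨p + 1, by omega⟩)
        (by simp only; omega) (by omega) (Finset.mem_erase.2 ⟨hvz.symm, hzS⟩)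
        (fun v h => Finset.mem_erase.2 ⟨h.ne', hS v (lt_trans (Fin.lt_def.2 (by simp)) h)⟩)
      rcases d with _ | d
      · refine le_trans ?_ (mul_add_mul_le_pathCount hv hzS hvz)
        rw [if_neg hvz, if_pos rfl, circulant_mult_one hn (by simp),
          circulant_mult_two hn (by omega)]
        simp only [lucasSeq] at h1 ⊢
        gcongr
      · have hw : (⟨p + 2, by omega⟩ : Fin n) ∈ S := hS _ (Fin.lt_def.2 (by simp))
        have hwz : (⟨p + 2, by omega⟩ : Fin n) ≠ z := by
          rw [ne_eq, Fin.ext_iff]; simp only; omega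
        have h2 := ih (d + 1) (by omega) ⟨p + 2, by omega⟩ m (S.erase ⟨p + 2, by omega⟩)
          (by simp only; omega) (by omega) (Finset.mem_erase.2 ⟨hwz.symm, hzS⟩)
          (fun v h => Finset.mem_erase.2 ⟨h.ne', hS v (lt_trans (Fin.lt_def.2 (by simp)) h)⟩)
        refine le_trans ?_ (mul_add_mul_le_pathCount hv hw (by simp))
        rw [if_neg hvz, if_neg hwz, circulant_mult_one hn (by simp),
          circulant_mult_two hn (by simp), lucasSeq, one_mul]
        gcongr

/-- A climb to `v_1` that avoids `v_0` must pass through `v_{n-1}` and jump by two, so the remaining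
free advance is only `n - 1 - p`. -/
theorem lucasSeq_le_pathCount_one (hn : 3 ≤ n) {z : Fin n} (hz : (z : ℕ) = 1) (d : ℕ) :
    ∀ (p : Fin n) (m : ℕ) (S : Finset (Fin n)), (p : ℕ) + d + 1 = n → 1 ≤ (p : ℕ) → d < m →
      z ∈ S → (∀ v, p < v → v ∈ S) →
        lucasSeq (k - 1) d ≤ pathCount (circulant n k).mult z m S p := by
  induction d using Nat.strong_induction_on with
  | _ d ih =>
    intro p m S hp hp1 hm hzS hS
    obtain ⟨m, rfl⟩ : ∃ m', m = m' + 1 := ⟨m - 1, by omega⟩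
    rcases d with _ | d
    · refine le_trans (le_of_eq ?_) (mul_le_pathCount hzS)
      rw [circulant_mult_two hn (by omega), if_pos rfl]
      rfl
    · have hv : (⟨p + 1, by omega⟩ : Fin n) ∈ S := hS _ (Fin.lt_def.2 (by simp))
      have hvz : (⟨p + 1, by omega⟩ : Fin n) ≠ z := by
        rw [ne_eq, Fin.ext_iff]; simp only; omega
      have h1 := ih d (by omega) ⟨p + 1, by omega⟩ m (S.erase ⟨p + 1, by omega⟩)
        (by simp only; omega) (by simp) (by omega) (Finset.mem_erase.2 ⟨hvz.symm, hzS⟩)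
        (fun v h => Finset.mem_erase.2 ⟨h.ne', hS v (lt_trans (Fin.lt_def.2 (by simp)) h)⟩)
      rcases d with _ | d
      · refine le_trans ?_ (mul_le_pathCount hv)
        rw [if_neg hvz, circulant_mult_one hn (by simp)]
        simp only [lucasSeq] at h1 ⊢
        exact Nat.le_mul_of_pos_right _ h1
      · have hw : (⟨p + 2, by omega⟩ : Fin n) ∈ S := hS _ (Fin.lt_def.2 (by simp))
        have hwz : (⟨p + 2, by omega⟩ : Fin n) ≠ z := by
          rw [ne_eq, Fin.ext_iff]; simp only; omega
        have h2 := ih d (by omega) ⟨p + 2, by omega⟩ m (S.erase ⟨p + 2, by omega⟩)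
          (by simp only; omega) (by simp) (by omega) (Finset.mem_erase.2 ⟨hwz.symm, hzS⟩)
          (fun v h => Finset.mem_erase.2 ⟨h.ne', hS v (lt_trans (Fin.lt_def.2 (by simp)) h)⟩)
        refine le_trans ?_ (mul_add_mul_le_pathCount hv hw (by simp))
        rw [if_neg hvz, if_neg hwz, circulant_mult_one hn (by simp),
          circulant_mult_two hn (by simp), lucasSeq, one_mul]
        gcongr

theorem one_le_pathCount_of_odd (hn : 3 ≤ n) {z : Fin n} (hz : (z : ℕ) = 0)
    (m : ℕ) : ∀ (p : Fin n) (S : Finset (Fin n)), Even (n - (p : ℕ)) → n - p ≤ 2 * m → z ∈ S →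
      (∀ v, p < v → Even (n - (v : ℕ)) → v ∈ S) →
        1 ≤ pathCount (circulant n k).mult z m S p := by
  induction m with
  | zero =>
    intro p S _ hm
    have := p.2
    omega
  | succ m ih =>
    intro p S hp hm hzS hS
    have hpn := p.2
    rw [Nat.even_iff] at hp
    by_cases h : (p : ℕ) + 2 = n
    · refine le_trans ?_ (mul_le_pathCount hzS)
      rw [circulant_mult_two hn (by omega), if_pos rfl]
    · have hw : (⟨p + 2, by omega⟩ : Fin n) ∈ S :=
        hS _ (Fin.lt_def.2 (by simp)) (Nat.even_iff.2 (by simp only; omega))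
      have hwz : (⟨p + 2, by omega⟩ : Fin n) ≠ z := by
        rw [ne_eq, Fin.ext_iff]; simp only; omega
      have h2 := ih ⟨p + 2, by omega⟩ (S.erase ⟨p + 2, by omega⟩)
        (Nat.even_iff.2 (by simp only; omega)) (by simp only; omega)
        (Finset.mem_erase.2 ⟨hwz.symm, hzS⟩)
        (fun v h h' =>
          Finset.mem_erase.2 ⟨h.ne', hS v (lt_trans (Fin.lt_def.2 (by simp)) h) h'⟩)
      refine le_trans ?_ (mul_le_pathCount hw)
      rwa [if_neg hwz, circulant_mult_two hn (by simp), one_mul]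

/-- The extra path uses only steps of length two: over the even vertices to `v_{n-1}`, then `v_1`,
then over the odd vertices back to `v_0`. The induction carries the `+ 1` along the two-step branch.
-/
theorem lucasSeq_add_one_le_pathCount (hn : 3 ≤ n) (hodd : Odd n) {z : Fin n} (hz : (z : ℕ) = 0)
    (m : ℕ) : ∀ (p : Fin n) (S : Finset (Fin n)), Odd (n - (p : ℕ)) → 2 * n ≤ 2 * m + p → z ∈ S →
      (∀ v, p < v → v ∈ S) → (∀ v : Fin n, Even (n - (v : ℕ)) → v ∈ S) →
        lucasSeq (k - 1) (n - p) + 1 ≤ pathCount (circulant n k).mult z m S p := by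
  induction m with
  | zero =>
    intro p S _ hm
    have := p.2
    omega
  | succ m ih =>
    intro p S hp hm hzS hS hS'
    have hpn := p.2
    rw [Nat.odd_iff] at hp hodd
    by_cases h : (p : ℕ) + 1 = n
    · have hv : (⟨1, by omega⟩ : Fin n) ∈ S := hS' _ (Nat.even_iff.2 (by simp only; omega))
      have hvz : (⟨1, by omega⟩ : Fin n) ≠ z := by
        rw [ne_eq, Fin.ext_iff]; simp only; omega
      have h1 := one_le_pathCount_of_odd (k := k) hn hz m ⟨1, by omega⟩ (S.erase ⟨1, by omega⟩)
        (Nat.even_iff.2 (by simp only; omega)) (by simp only; omega)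
        (Finset.mem_erase.2 ⟨hvz.symm, hzS⟩)
        (fun v h h' => Finset.mem_erase.2 ⟨h.ne', hS' v h'⟩)
      refine le_trans ?_ (mul_add_mul_le_pathCount hzS hv hvz.symm)
      rw [if_neg hvz, if_pos rfl, circulant_mult_one hn (by omega),
        circulant_mult_two hn (by simp only; omega), show n - (p : ℕ) = 1 by omega, mul_one,
        one_mul, lucasSeq]
      gcongr
    · have hv : (⟨p + 1, by omega⟩ : Fin n) ∈ S := hS _ (Fin.lt_def.2 (by simp))
      have hvz : (⟨p + 1, by omega⟩ : Fin n) ≠ z := by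
        rw [ne_eq, Fin.ext_iff]; simp only; omega
      have hw : (⟨p + 2, by omega⟩ : Fin n) ∈ S := hS _ (Fin.lt_def.2 (by simp))
      have hwz : (⟨p + 2, by omega⟩ : Fin n) ≠ z := by
        rw [ne_eq, Fin.ext_iff]; simp only; omega
      have h1 := lucasSeq_le_pathCount_zero (k := k) hn hz (n - (p + 1)) ⟨p + 1, by omega⟩ m
        (S.erase ⟨p + 1, by omega⟩) (by simp only; omega) (by omega)
        (Finset.mem_erase.2 ⟨hvz.symm, hzS⟩)
        (fun v h => Finset.mem_erase.2 ⟨h.ne', hS v (lt_trans (Fin.lt_def.2 (by simp)) h)⟩)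
      have h2 := ih ⟨p + 2, by omega⟩ (S.erase ⟨p + 2, by omega⟩)
        (Nat.odd_iff.2 (by simp only; omega)) (by simp only; omega)
        (Finset.mem_erase.2 ⟨hwz.symm, hzS⟩)
        (fun v h => Finset.mem_erase.2 ⟨h.ne', hS v (lt_trans (Fin.lt_def.2 (by simp)) h)⟩)
        (fun v h => Finset.mem_erase.2 ⟨?_, hS' v h⟩)
      · refine le_trans ?_ (mul_add_mul_le_pathCount hv hw (by simp))
        rw [if_neg hvz, if_neg hwz, circulant_mult_one hn (by simp),
          circulant_mult_two hn (by simp), one_mul]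
        obtain ⟨d, hd⟩ : ∃ d, n - (p : ℕ) = d + 2 := ⟨n - p - 2, by omega⟩
        rw [show n - ((p : ℕ) + 1) = d + 1 by omega] at h1
        simp only [show n - ((p : ℕ) + 2) = d by omega] at h2
        rw [hd, lucasSeq, add_assoc]
        gcongr
      · rintro rfl
        rw [Nat.even_iff] at h
        simp only at h
        omega

theorem pow_cycleGrowth_le_numCycles (hn : 3 ≤ n) (hk : 2 ≤ k) :
    cycleGrowth k ^ n ≤ ((circulant n k).numCycles : ℝ) := by
  have hα := cycleGrowth_sq (k := k) (by omega)
  have hβ0 := natCast_pred_le_cycleGrowth (k := k) (by omega)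
  have hβ1 := cycleGrowth_le hk
  set α := cycleGrowth k
  set β := ((k - 1 : ℕ) : ℝ) - α with hβ
  have hu := lucasSeq_add hα (β := β) (by rw [hβ]; linear_combination hα) (by rw [hβ]; ring) (n - 2)
  rw [show n - 2 + 2 = n by omega] at hu
  let z : Fin n := ⟨0, by omega⟩
  let o : Fin n := ⟨1, by omega⟩
  have hzo : z ≠ o := by simp [z, o]
  have hle : pathCount (circulant n k).mult z n (Finset.Ici z) z +
      pathCount (circulant n k).mult o n (Finset.Ici o) o ≤ (circulant n k).numCycles := by
    rw [numCycles_eq_sum_pathCount, ← Finset.sum_pair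
      (f := fun i => pathCount (circulant n k).mult i n (Finset.Ici i) i) hzo]
    exact Finset.sum_le_sum_of_subset (Finset.subset_univ _)
  have ho : lucasSeq (k - 1) (n - 2) ≤ pathCount (circulant n k).mult o n (Finset.Ici o) o :=
    lucasSeq_le_pathCount_one hn rfl (n - 2) o n _ (by simp only [o]; omega) le_rfl (by omega)
      (by simp) (fun v h => Finset.mem_Ici.2 h.le)
  rcases Nat.even_or_odd n with he | hodd
  · have hz : lucasSeq (k - 1) n ≤ pathCount (circulant n k).mult z n (Finset.Ici z) z :=
      lucasSeq_le_pathCount_zero hn rfl n z n _ (by simp [z]) le_rfl (by simp)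
        (fun v h => Finset.mem_Ici.2 h.le)
    have h2 : ((lucasSeq (k - 1) n + lucasSeq (k - 1) (n - 2) : ℕ) : ℝ) ≤
        (circulant n k).numCycles := by exact_mod_cast (add_le_add hz ho).trans hle
    have := he.pow_nonneg β
    linarith
  · have hz : lucasSeq (k - 1) n + 1 ≤ pathCount (circulant n k).mult z n (Finset.Ici z) z :=
      lucasSeq_add_one_le_pathCount hn hodd rfl n z _ (by simpa [z] using hodd) (by simp) (by simp)
        (fun v h => Finset.mem_Ici.2 h.le)
        (fun v _ => Finset.mem_Ici.2 (Fin.le_def.2 (Nat.zero_le _)))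
    have h2 : ((lucasSeq (k - 1) n + lucasSeq (k - 1) (n - 2) : ℕ) : ℝ) + 1 ≤
        (circulant n k).numCycles := by
      have := (add_le_add hz ho).trans hle
      exact_mod_cast (by omega : lucasSeq (k - 1) n + lucasSeq (k - 1) (n - 2) + 1 ≤ _)
    -- For odd `n` this says `β ^ n ≥ -1`, and the doubly winding cycle supplies the missing `1`.
    have h3 : (-β) ^ n ≤ 1 := pow_le_one₀ (by rw [hβ]; linarith) (by rw [hβ]; linarith)
    rw [hodd.neg_pow] at h3
    linarith

end Circulant

end MultiDigraph

/-! ### Comparison with Fibonacci numbers and the final assembly. -/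

theorem isTheta_pow_fib {α : ℝ} (h1 : 1 ≤ α) (h2 : α ≤ 2) (h : α ^ 2 = α + 1) :
    (fun n : ℕ => α ^ n) =Θ[atTop] (fun n : ℕ => (Nat.fib n : ℝ)) := by
  have hupper : ∀ n : ℕ, α ^ (n + 1) ≤ 3 * (Nat.fib (n + 1) : ℝ) := by
    intro n
    induction n using Nat.twoStepInduction with
    | zero => simp; linarith
    | one => simp [h]; linarith
    | more n ih1 ih2 =>
      rw [Nat.fib_add_two (n := n + 1), Nat.cast_add,
        show α ^ (n + 2 + 1) = α ^ (n + 1) + α ^ (n + 1 + 1) by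
          linear_combination α ^ (n + 1) * h]
      linarith
  have hlower : ∀ n : ℕ, (Nat.fib n : ℝ) ≤ α ^ n := by
    intro n
    induction n using Nat.twoStepInduction with
    | zero => simp
    | one => simpa using h1
    | more n ih1 ih2 =>
      rw [Nat.fib_add_two, Nat.cast_add,
        show α ^ (n + 2) = α ^ n + α ^ (n + 1) by linear_combination α ^ n * h]
      linarith
  constructor
  · refine IsBigO.of_bound 3 ?_
    filter_upwards [eventually_ge_atTop 1] with n hn
    obtain ⟨n, rfl⟩ := Nat.exists_eq_add_of_le' hn
    rw [Real.norm_of_nonneg (by positivity), Real.norm_of_nonneg (by positivity)]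
    exact hupper n
  · refine IsBigO.of_bound 1 (Eventually.of_forall fun n => ?_)
    rw [Real.norm_of_nonneg (by positivity), Real.norm_of_nonneg (by positivity), one_mul]
    exact hlower n

theorem mainTheorem3 :
    (∀ k : ℕ, 2 ≤ k →
      ((fun n : ℕ => (MultiDigraph.maxCycles k n : ℝ)) =Θ[atTop]
        (fun n : ℕ => cycleGrowth k ^ n)) ∧
      (∀ n : ℕ, (MultiDigraph.maxCycles k n : ℝ) ≤ 5 * cycleGrowth k ^ n) ∧
      (∀ n : ℕ, 3 ≤ n →
        MultiDigraph.circulant n k ∈ MultiDigraph.multiClass n k ∧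
        cycleGrowth k ^ n ≤ ((MultiDigraph.circulant n k).numCycles : ℝ) ∧
        (MultiDigraph.circulant n k).numCycles ≤ MultiDigraph.maxCycles k n)) ∧
    ((fun n : ℕ => (MultiDigraph.maxCycles 2 n : ℝ)) =Θ[atTop]
      (fun n : ℕ => (Nat.fib n : ℝ))) := by
  have hcirc : ∀ k n : ℕ, 2 ≤ k → 3 ≤ n →
      (MultiDigraph.circulant n k).numCycles ≤ MultiDigraph.maxCycles k n := fun k n hk hn =>
    (MultiDigraph.isGreatest_maxCycles k n).2
      (Set.mem_image_of_mem _ (MultiDigraph.circulant_mem_multiClass hn hk))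
  have htheta : ∀ k : ℕ, 2 ≤ k → (fun n : ℕ => (MultiDigraph.maxCycles k n : ℝ)) =Θ[atTop]
      (fun n : ℕ => cycleGrowth k ^ n) := by
    intro k hk
    have hpos := cycleGrowth_pos k
    constructor
    · refine IsBigO.of_bound 5 (Eventually.of_forall fun n => ?_)
      rw [Real.norm_of_nonneg (by positivity), Real.norm_of_nonneg (by positivity)]
      exact MultiDigraph.maxCycles_le hk n
    · refine IsBigO.of_bound 1 ?_
      filter_upwards [eventually_ge_atTop 3] with n hn
      rw [Real.norm_of_nonneg (by positivity), Real.norm_of_nonneg (by positivity), one_mul]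
      exact (MultiDigraph.pow_cycleGrowth_le_numCycles hn hk).trans
        (by exact_mod_cast hcirc k n hk hn)
  refine ⟨fun k hk => ⟨htheta k hk, MultiDigraph.maxCycles_le hk, fun n hn =>
    ⟨MultiDigraph.circulant_mem_multiClass hn hk,
      MultiDigraph.pow_cycleGrowth_le_numCycles hn hk, hcirc k n hk hn⟩⟩, ?_⟩
  have h1 := one_point_six_le_cycleGrowth le_rfl
  have h2 := cycleGrowth_le le_rfl
  have h3 := cycleGrowth_sq (k := 2) (by norm_num)
  norm_num at h1 h2 h3
  exact (htheta 2 le_rfl).trans (isTheta_pow_fib (by linarith) (by linarith) (by linarith))
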